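/- Let $0\le p_1<1$, $p_2>0$, $q_1>0$, $q_2\ge 0$, and let $u,v\in C^4(\mathbb{R}^4)$ with $u>0$ satisfy $$-\Delta u=u^{p_1}e^{q_1v},\qquad (-\Delta)^2v=u^{p_2}e^{q_2v}\qquad\text{in }\mathbb{R}^4,$$ $$\int_{\mathbb{R}^4}u^{p_1}e^{q_1v}\,dx<\infty,\qquad \int_{\mathbb{R}^4}u^{p_2}e^{q_2v}\,dx<\infty,\qquad v(x)=o(|x|^2)\ \text{ as }|x|\to\infty .$$ Let $\omega_3$ be the surface area of the unit sphere of $\mathbb{R}^4$ and $\alpha=\frac1{4\omega_3}\int_{\mathbb{R}^4}u^{p_2}e^{q_2v}\,dy$. Then there is a constant $c_0\in\mathbb{R}$ such that for every $x\in\mathbb{R}^4$ $$v(x)=-\frac1{4\omega_3}\int_{\mathbb{R}^4}\bigl[\ln|x-y|-\ln(|y|+1)\bigr]u^{p_2}(y)e^{q_2v(y)}\,dy+c_0,$$ $$\nabla v(x)=-\frac1{4\omega_3}\int_{\mathbb{R}^4}\frac{x-y}{|x-y|^2}\,u^{p_2}(y)e^{q_2v(y)}\,dy,\qquad \Delta v(x)=-\frac1{2\omega_3}\int_{\mathbb{R}^4}\frac{u^{p_2}(y)e^{q_2v(y)}}{|x-y|^2}\,dy,$$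 all integrals being absolutely convergent. If moreover at least one of the following holds: 1. $\int_{\mathbb{R}^4}e^{3v}\,dx<\infty$ and $\int_{\mathbb{R}^4}u^4\,dx<\infty$; 2. $\int_{\mathbb{R}^4}u^{\tau}\,dx<\infty$ for some $\tau>p_2$, and $v(x)=O(\ln|x|)$ as $|x|\to\infty$; then $$\lim_{|x|\to\infty}\frac{v(x)}{\ln|x|}=-\alpha .$$ -/

import Mathlib

open MeasureTheory Filter Asymptotics Topology
open scoped Laplacian

/-- The space `ℝ⁴` with its Euclidean norm. -/
abbrev R4 : Type := EuclideanSpace ℝ (Fin 4)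

/-- `ω₃`: the total surface measure of the unit sphere of `ℝ⁴`. -/
noncomputable def omega3 : ℝ := (volume : Measure R4).toSphere.real Set.univ

/-- The nonlinearity `y ↦ u(y)ᵖ e^{q v(y)}`. -/
noncomputable def nonlin (p q : ℝ) (u v : R4 → ℝ) (y : R4) : ℝ :=
  u y ^ p * Real.exp (q * v y)

/-- `(u, v)` is a classical (`C⁴`) solution, with `u > 0` and both right-hand sides integrable, of
`-Δu = u^{p₁} e^{q₁ v}`, `(-Δ)² v = u^{p₂} e^{q₂ v}` on `ℝ⁴`. -/
structure IsSolution (p₁ q₁ p₂ q₂ : ℝ) (u v : R4 → ℝ) : Prop where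
  contDiff_u : ContDiff ℝ 4 u
  contDiff_v : ContDiff ℝ 4 v
  pos : ∀ x, 0 < u x
  eq_u : ∀ x, -(Δ u) x = nonlin p₁ q₁ u v x
  eq_v : ∀ x, (-(Δ (-(Δ v)))) x = nonlin p₂ q₂ u v x
  integrable_u : Integrable (nonlin p₁ q₁ u v)
  integrable_v : Integrable (nonlin p₂ q₂ u v)

/-- First alternative assumption: `∫ e^{3v} < ∞` and `∫ u⁴ < ∞`. -/
def AssumptionH1 (u v : R4 → ℝ) : Prop :=
  Integrable (fun x => Real.exp (3 * v x)) ∧ Integrable (fun x => u x ^ 4)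

/-- Second alternative assumption: `∫ u^τ < ∞` for some `τ > p₂`, and `v(x) = O(ln |x|)` as
`|x| → ∞`. -/
def AssumptionH2 (p₂ : ℝ) (u v : R4 → ℝ) : Prop :=
  (∃ τ : ℝ, p₂ < τ ∧ Integrable (fun x => u x ^ τ)) ∧
    v =O[cocompact R4] fun x => Real.log ‖x‖

/-- `α = (1 / (4 ω₃)) ∫ u^{p₂} e^{q₂ v}`. -/
noncomputable def alphaConst (p₂ q₂ : ℝ) (u v : R4 → ℝ) : ℝ :=
  1 / (4 * omega3) * ∫ y, nonlin p₂ q₂ u v y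

/-! Write `f` for `nonlin p₂ q₂ u v` and `b_k(y) = (1 - |y|²)₊ᵏ`. Since `∇b_{k+1} = -2(k+1) b_k y`,
integration by parts shows that the `r`-derivative of the `b_k`-weighted mean of `w` is `r/(2(k+1))`
times the `b_{k+1}`-weighted mean of `Δw`. These solid means replace spherical means. One use gives
Green's formula for `-Δ` (`wmean_add_integral_eq`); a second gives, for `v`, `wmean 1 v x r +
(1/384) ∫ Q(r²/|y|²) f(x+y) dy + L(x) r² = v(x) ω₃/12`, where `Q` is `logProfile`, asymptotic to `4
log`, and `L(x)` is a multiple of the difference between `-Δv(x)` and the Newtonian potential of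
`f`.

Divide by `r²`: the growth hypothesis kills the mean and the integral is `o(r)`, so `L = 0`, which
is the formula for `Δv` (`laplacian_eq_newtonian`). Subtract the identities at `x` and `0` and let
`r → ∞`: the difference of the two `Q`-terms tends to the logarithmic kernel, and the two means
merge provided the mean of `|v|` is `o(r)` (`sub_eq_integral_log`). That is where the equation for
`u` enters. A positive superharmonic `u` is at least `c(1+|x|)⁻²`, so taking logarithms in `g =
u^{p₁} e^{q₁ v}` and using `log g ≤ g` bounds `v` above by a function with mean `O(log r)`; the
identity for the mean of `v` itself then controls `|v| ≤ 2ψ - v` (`tendsto_wmean_abs_div`). The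
gradient formula follows by regularising the logarithm.

For the limit, split `log d = log max(d,1) - negLog d`. The first part yields `(∫ f) log|x|` by
dominated convergence. The second is `o(log|x|)` as soon as some `∫_{B(x,1)} f^s` with `s > 1` grows
at most polynomially (`tendsto_negLog_potential_div`). The second alternative gives this directly
with `s = τ/p₂`. Under the first, the mass of `f` on `B(x,2)` tends to `0`, so a Brezis–Merle
estimate controls every exponential `e^{kv}` on unit balls; Green's formula and `u⁴ ∈ L¹` then make
`u` polynomially bounded, and `s = 2` works. -/

/-! ### Radial weights of compact support -/

/-- The compactly supported radial weight `(1 - |y|²)₊ᵏ`. -/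
noncomputable def bump (k : ℕ) (y : R4) : ℝ := (max 0 (1 - ‖y‖ ^ 2)) ^ k

/-- The unnormalised weighted mean of `w` over the ball of radius `r` about `x`. -/
noncomputable def wmean (k : ℕ) (w : R4 → ℝ) (x : R4) (r : ℝ) : ℝ :=
  ∫ y, w (x + r • y) * bump k y

lemma bump_nonneg (k : ℕ) (y : R4) : 0 ≤ bump k y := by unfold bump; positivity

lemma bump_le_one (k : ℕ) (y : R4) : bump k y ≤ 1 :=
  pow_le_one₀ (le_max_left _ _) (max_le zero_le_one (by nlinarith [sq_nonneg ‖y‖]))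

lemma continuous_bump (k : ℕ) : Continuous (bump k) := by unfold bump; fun_prop

lemma bump_eq_zero {k : ℕ} (hk : k ≠ 0) {y : R4} (hy : 1 ≤ ‖y‖) : bump k y = 0 := by
  unfold bump
  rw [max_eq_left (by nlinarith), zero_pow hk]

lemma norm_lt_one_of_bump_ne_zero {k : ℕ} (hk : k ≠ 0) {y : R4} (hy : bump k y ≠ 0) :
    ‖y‖ < 1 := by
  by_contra h
  exact hy (bump_eq_zero hk (not_lt.1 h))

lemma hasCompactSupport_bump {k : ℕ} (hk : k ≠ 0) : HasCompactSupport (bump k) :=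
  HasCompactSupport.of_support_subset_isCompact (isCompact_closedBall 0 1) fun y hy => by
    simpa using (norm_lt_one_of_bump_ne_zero hk hy).le

lemma integrable_mul_bump {k : ℕ} (hk : k ≠ 0) {h : R4 → ℝ} (hh : Continuous h) :
    Integrable fun y => h y * bump k y :=
  (hh.mul (continuous_bump k)).integrable_of_hasCompactSupport
    (hasCompactSupport_bump hk).mul_left

lemma integrable_bump {k : ℕ} (hk : k ≠ 0) : Integrable (bump k) := by
  simpa using integrable_mul_bump hk (h := fun _ => 1) continuous_const

lemma hasDerivAt_max_zero_pow (k : ℕ) (hk : k ≠ 0) (s : ℝ) :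
    HasDerivAt (fun s : ℝ => (max 0 s) ^ (k + 1)) ((k + 1) * (max 0 s) ^ k) s := by
  rcases lt_trichotomy s 0 with h | h | h
  · rw [max_eq_left h.le, zero_pow hk, mul_zero]
    refine (hasDerivAt_const s (0 : ℝ)).congr_of_eventuallyEq ?_
    filter_upwards [Iio_mem_nhds h] with t ht
    rw [max_eq_left (le_of_lt ht), zero_pow (by omega)]
  -- At the kink the function is `O(h^(k+1))` with `k + 1 > 1`, so its derivative vanishes.
  · subst h
    rw [max_self, zero_pow hk, mul_zero]
    rw [hasDerivAt_iff_isLittleO_nhds_zero]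
    simp only [zero_add, max_self, smul_zero, sub_zero]
    rw [zero_pow (by omega)]
    simp only [sub_zero]
    refine IsBigO.trans_isLittleO (g := fun h : ℝ => h ^ (k + 1)) ?_ ?_
    · refine IsBigO.of_bound 1 (Eventually.of_forall fun h => ?_)
      rw [norm_pow, norm_pow, one_mul]
      gcongr
      rcases le_total 0 h with h0 | h0
      · simp [h0]
      · simp [h0]
    · simpa using (isLittleO_pow_pow (𝕜 := ℝ) (show 1 < k + 1 by omega))
  · have h1 : HasDerivAt (fun s : ℝ => s ^ (k + 1)) ((k + 1) * s ^ k) s := by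
      simpa using hasDerivAt_pow (k + 1) s
    rw [max_eq_right h.le]
    refine h1.congr_of_eventuallyEq ?_
    filter_upwards [Ioi_mem_nhds h] with t ht
    rw [max_eq_right (le_of_lt ht)]

/-- Differentiating costs one exponent and produces the factor `y`; this recursion is what links the
weighted means of index `k` and `k + 1`. -/
lemma hasFDerivAt_bump {k : ℕ} (hk : k ≠ 0) (y : R4) :
    HasFDerivAt (bump (k + 1)) ((-(2 * (k + 1) * bump k y)) • innerSL ℝ y) y := by
  have h1 : HasFDerivAt (fun y : R4 => 1 - ‖y‖ ^ 2) (-(2 • innerSL ℝ y)) y := by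
    simpa using (hasStrictFDerivAt_norm_sq y).hasFDerivAt.const_sub 1
  have h2 := (hasDerivAt_max_zero_pow k hk (1 - ‖y‖ ^ 2)).comp_hasFDerivAt y h1
  refine h2.congr_fderiv ?_
  ext z
  simp [bump]
  ring

/-! ### The Laplacian and the radial derivative of weighted means -/

lemma laplacian_eq_sum_fderiv {w : R4 → ℝ} (hw : ContDiff ℝ 2 w) (x : R4) :
    (Δ w) x = ∑ i, fderiv ℝ (fun y => fderiv ℝ w y (EuclideanSpace.basisFun (Fin 4) ℝ i)) x
      (EuclideanSpace.basisFun (Fin 4) ℝ i) := by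
  rw [InnerProductSpace.laplacian_eq_iteratedFDeriv_orthonormalBasis w
    (EuclideanSpace.basisFun (Fin 4) ℝ)]
  refine Finset.sum_congr rfl fun i _ => ?_
  have hd : DifferentiableAt ℝ (fderiv ℝ w) x :=
    ((hw.fderiv_right (m := 1) (by norm_num)).differentiable (by norm_num)) x
  rw [iteratedFDeriv_two_apply, fderiv_clm_apply hd (differentiableAt_const _)]
  simp

lemma continuous_laplacian {w : R4 → ℝ} (hw : ContDiff ℝ 2 w) : Continuous (Δ w) := by
  have h : (Δ w) = fun x => ∑ i, fderiv ℝ (fun y => fderiv ℝ w y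
      (EuclideanSpace.basisFun (Fin 4) ℝ i)) x (EuclideanSpace.basisFun (Fin 4) ℝ i) :=
    funext (laplacian_eq_sum_fderiv hw)
  rw [h]
  refine continuous_finsetSum _ fun i _ => ?_
  have h1 : ContDiff ℝ 1 (fun y => fderiv ℝ w y (EuclideanSpace.basisFun (Fin 4) ℝ i)) :=
    (hw.fderiv_right (m := 1) (by norm_num)).clm_apply contDiff_const
  exact (h1.continuous_fderiv (by norm_num)).clm_apply continuous_const

lemma contDiff_laplacian {w : R4 → ℝ} (hw : ContDiff ℝ 4 w) : ContDiff ℝ 2 (Δ w) := by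
  have h : (Δ w) = fun x => ∑ i, fderiv ℝ (fun y => fderiv ℝ w y
      (EuclideanSpace.basisFun (Fin 4) ℝ i)) x (EuclideanSpace.basisFun (Fin 4) ℝ i) :=
    funext (laplacian_eq_sum_fderiv (hw.of_le (by norm_num)))
  rw [h]
  refine ContDiff.sum fun i _ => ?_
  have h1 : ContDiff ℝ 3 (fun y => fderiv ℝ w y (EuclideanSpace.basisFun (Fin 4) ℝ i)) :=
    (hw.fderiv_right (m := 3) (by norm_num)).clm_apply contDiff_const
  exact (h1.fderiv_right (m := 2) (by norm_num)).clm_apply contDiff_const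

/-- Integration by parts against a weight. -/
lemma integral_fderiv_mul_bump {k : ℕ} (hk : k ≠ 0) {h : R4 → ℝ} (hh : ContDiff ℝ 1 h)
    (x : R4) (r : ℝ) (e : R4) :
    ∫ y, h (x + r • y) * inner ℝ y e * bump k y =
      r / (2 * (k + 1)) * ∫ y, fderiv ℝ h (x + r • y) e * bump (k + 1) y := by
  have hc : Continuous fun y : R4 => x + r • y := by fun_prop
  have hhr : ∀ y : R4, HasFDerivAt (fun y => h (x + r • y)) (r • fderiv ℝ h (x + r • y)) y := by
    intro y
    have h1 : HasFDerivAt (fun y : R4 => x + r • y) (r • ContinuousLinearMap.id ℝ R4) y :=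
      ((hasFDerivAt_id y).const_smul r).const_add x
    have h2 := ((hh.differentiable (by norm_num)) (x + r • y)).hasFDerivAt.comp y h1
    refine h2.congr_fderiv ?_
    ext z; simp
  have hdc : Continuous fun y : R4 => fderiv ℝ h (x + r • y) e :=
    ((hh.continuous_fderiv (by norm_num)).comp hc).clm_apply continuous_const
  have hin : Continuous fun y : R4 => inner ℝ y e := by fun_prop
  have key := integral_mul_fderiv_eq_neg_fderiv_mul_of_integrable (μ := (volume : Measure R4))
    (f := fun y => h (x + r • y)) (g := bump (k + 1)) (v := e) ?_ ?_ ?_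
    (fun y _ => (hhr y).differentiableAt) (fun y _ => (hasFDerivAt_bump hk y).differentiableAt)
  · have e1 : (fun y => h (x + r • y) * fderiv ℝ (bump (k + 1)) y e) =
        fun y => (-(2 * (k + 1) : ℝ)) * (h (x + r • y) * inner ℝ y e * bump k y) := by
      ext y
      rw [(hasFDerivAt_bump hk y).fderiv]
      simp
      ring
    have e2 : (fun y => fderiv ℝ (fun y => h (x + r • y)) y e * bump (k + 1) y) =
        fun y => r * (fderiv ℝ h (x + r • y) e * bump (k + 1) y) := by
      ext y
      rw [(hhr y).fderiv]
      simp
      ring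
    rw [e1, e2, integral_const_mul, integral_const_mul] at key
    have : (2 * (k + 1) : ℝ) ≠ 0 := by positivity
    field_simp
    linarith
  · have e2 : (fun y => fderiv ℝ (fun y => h (x + r • y)) y e * bump (k + 1) y) =
        fun y => r * fderiv ℝ h (x + r • y) e * bump (k + 1) y := by
      ext y
      rw [(hhr y).fderiv]
      simp
    rw [e2]
    exact integrable_mul_bump (by omega) (hdc.const_mul r)
  · have e1 : (fun y => h (x + r • y) * fderiv ℝ (bump (k + 1)) y e) =
        fun y => (-(2 * (k + 1) : ℝ)) * (h (x + r • y) * inner ℝ y e) * bump k y := by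
      ext y
      rw [(hasFDerivAt_bump hk y).fderiv]
      simp
      ring
    rw [e1]
    exact integrable_mul_bump hk (((hh.continuous.comp hc).mul hin).const_mul _)
  · exact integrable_mul_bump (by omega) (hh.continuous.comp hc)

/-- Differentiation under the integral gives `∇w(x+ry)·y bump k y`, and `bump k y` times `y` is a
multiple of the gradient of `bump (k+1)`; integrating by parts in each coordinate produces the
Laplacian. -/
lemma hasDerivAt_wmean {k : ℕ} (hk : k ≠ 0) {w : R4 → ℝ} (hw : ContDiff ℝ 2 w) (x : R4) (r : ℝ) :
    HasDerivAt (wmean k w x) (r / (2 * (k + 1)) * wmean (k + 1) (Δ w) x r) r := by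
  have hdw : Continuous (fderiv ℝ w) := hw.continuous_fderiv (by norm_num)
  have hcont : Continuous fun p : ℝ × R4 => fderiv ℝ w (x + p.1 • p.2) p.2 :=
    (hdw.comp (by fun_prop)).clm_apply continuous_snd
  -- The weight vanishes outside the unit ball, so a bound on a compact set dominates the integrand
  -- for all `s` near `r`.
  obtain ⟨C, hC⟩ := ((isCompact_closedBall r 1).prod
    (isCompact_closedBall (0 : R4) 1)).exists_bound_of_continuousOn hcont.continuousOn
  have hC' : ∀ s ∈ Metric.ball r 1, ∀ y : R4,
      ‖fderiv ℝ w (x + s • y) y * bump k y‖ ≤ C * bump k y := by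
    intro s hs y
    rw [norm_mul, Real.norm_of_nonneg (bump_nonneg k y)]
    by_cases hy : bump k y = 0
    · simp [hy]
    · refine mul_le_mul_of_nonneg_right (hC (s, y) ⟨Metric.ball_subset_closedBall hs, ?_⟩)
        (bump_nonneg k y)
      simpa using (norm_lt_one_of_bump_ne_zero hk hy).le
  have hD := (hasDerivAt_integral_of_dominated_loc_of_deriv_le (μ := (volume : Measure R4))
    (F := fun s y => w (x + s • y) * bump k y)
    (F' := fun s y => fderiv ℝ w (x + s • y) y * bump k y)
    (bound := fun y => C * bump k y)
    (Metric.ball_mem_nhds r one_pos)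
    (Eventually.of_forall fun s =>
      ((hw.continuous.comp (by fun_prop)).mul (continuous_bump k)).aestronglyMeasurable)
    (integrable_mul_bump hk (hw.continuous.comp (by fun_prop)))
    (((hcont.comp (by fun_prop : Continuous fun y : R4 => (r, y))).mul
      (continuous_bump k)).aestronglyMeasurable)
    (Eventually.of_forall fun y s hs => hC' s hs y)
    ((integrable_bump hk).const_mul C)
    (Eventually.of_forall fun y s _ => by
      have h1 : HasDerivAt (fun s : ℝ => x + s • y) y s := by
        simpa using ((hasDerivAt_id s).smul_const y).const_add x
      exact ((((hw.differentiable (by norm_num)) _).hasFDerivAt.comp_hasDerivAt s h1).mul_const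
        (bump k y)))).2
  refine hD.congr_deriv ?_
  symm
  let b := EuclideanSpace.basisFun (Fin 4) ℝ
  have hb : ∀ i, ContDiff ℝ 1 fun y => fderiv ℝ w y (b i) := fun i =>
    (hw.fderiv_right (m := 1) (by norm_num)).clm_apply contDiff_const
  have e1 : ∀ y : R4, fderiv ℝ w (x + r • y) y * bump k y =
      ∑ i, fderiv ℝ w (x + r • y) (b i) * inner ℝ y (b i) * bump k y := by
    intro y
    have h3 : fderiv ℝ w (x + r • y) y = ∑ i, inner ℝ y (b i) * fderiv ℝ w (x + r • y) (b i) := by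
      generalize fderiv ℝ w (x + r • y) = L
      conv_lhs => rw [← b.sum_repr' y, map_sum]
      simp [real_inner_comm]
    rw [h3, Finset.sum_mul]
    exact Finset.sum_congr rfl fun i _ => by ring
  have e2 : ∀ y : R4, (Δ w) (x + r • y) * bump (k + 1) y =
      ∑ i, fderiv ℝ (fun y => fderiv ℝ w y (b i)) (x + r • y) (b i) * bump (k + 1) y := by
    intro y
    rw [laplacian_eq_sum_fderiv hw, Finset.sum_mul]
  unfold wmean
  simp_rw [e1, e2]
  rw [integral_finsetSum, integral_finsetSum, Finset.mul_sum]
  · exact Finset.sum_congr rfl fun i _ => (integral_fderiv_mul_bump hk (hb i) x r (b i)).symm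
  · intro i _
    exact integrable_mul_bump hk ((((hb i).continuous.comp (by fun_prop))).mul (by fun_prop))
  · intro i _
    exact integrable_mul_bump (by omega) ((((hb i).continuous_fderiv (by norm_num)).comp
      (by fun_prop)).clm_apply continuous_const)

/-! ### Normalising constants and integrability of the kernel -/

lemma omega3_eq : omega3 = 4 * (volume : Measure R4).real (Metric.ball 0 1) := by
  unfold omega3
  rw [Measure.toSphere_real_apply_univ]
  simp

lemma omega3_pos : 0 < omega3 := by
  rw [omega3_eq]
  have : 0 < (volume : Measure R4).real (Metric.ball 0 1) :=
    ENNReal.toReal_pos (Metric.measure_ball_pos volume _ one_pos).ne' measure_ball_lt_top.ne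
  positivity

lemma integral_bump (k : ℕ) (hk : k ≠ 0) :
    ∫ y, bump k y = omega3 * ∫ s in (0 : ℝ)..1, s ^ 3 * (1 - s ^ 2) ^ k := by
  unfold bump
  rw [integral_fun_norm_addHaar (volume : Measure R4) (fun s => (max 0 (1 - s ^ 2)) ^ k), omega3_eq,
    intervalIntegral.integral_of_le zero_le_one]
  have h1 : ∫ s in Set.Ioi (0 : ℝ), s ^ (Module.finrank ℝ R4 - 1) • (max 0 (1 - s ^ 2)) ^ k =
      ∫ s in Set.Ioc (0 : ℝ) 1, s ^ (Module.finrank ℝ R4 - 1) • (max 0 (1 - s ^ 2)) ^ k := by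
    refine (setIntegral_eq_of_subset_of_forall_sdiff_eq_zero measurableSet_Ioi
      Set.Ioc_subset_Ioi_self ?_)
    rintro s ⟨hs, hs'⟩
    have : 1 < s := by
      by_contra h
      exact hs' ⟨hs, not_lt.1 h⟩
    rw [max_eq_left (by nlinarith), zero_pow hk, smul_zero]
  rw [h1]
  have h2 : ∫ s in Set.Ioc (0 : ℝ) 1, s ^ (Module.finrank ℝ R4 - 1) • (max 0 (1 - s ^ 2)) ^ k =
      ∫ s in Set.Ioc (0 : ℝ) 1, s ^ 3 * (1 - s ^ 2) ^ k := by
    refine setIntegral_congr_fun measurableSet_Ioc fun s hs => ?_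
    have : 0 ≤ 1 - s ^ 2 := by nlinarith [hs.1, hs.2]
    simp [max_eq_right this]
  rw [h2]
  simp
  ring

lemma integral_bump_one : ∫ y, bump 1 y = omega3 / 12 := by
  rw [integral_bump 1 one_ne_zero]
  have : ∫ s in (0 : ℝ)..1, s ^ 3 * (1 - s ^ 2) ^ 1 = 1 / 12 := by
    have : (fun s : ℝ => s ^ 3 * (1 - s ^ 2) ^ 1) = fun s => s ^ 3 - s ^ 5 := by
      ext s; ring
    rw [this, intervalIntegral.integral_sub (by simp) (by simp)]
    simp
    norm_num
  rw [this]; ring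

lemma integral_bump_two : ∫ y, bump 2 y = omega3 / 24 := by
  rw [integral_bump 2 two_ne_zero]
  have : ∫ s in (0 : ℝ)..1, s ^ 3 * (1 - s ^ 2) ^ 2 = 1 / 24 := by
    have : (fun s : ℝ => s ^ 3 * (1 - s ^ 2) ^ 2) = fun s => s ^ 3 - 2 * s ^ 5 + s ^ 7 := by
      ext s; ring
    rw [this, intervalIntegral.integral_add (by simp) (by simp),
      intervalIntegral.integral_sub (by simp) (by simp)]
    simp
    norm_num
  rw [this]; ring

lemma integrableOn_rpow_norm_ball {a : ℝ} (ha : -4 < a) :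
    IntegrableOn (fun y : R4 => ‖y‖ ^ a) (Metric.ball 0 1) := by
  rw [integrableOn_fun_norm_addHaar (volume : Measure R4) (f := fun s => s ^ a)]
  have h1 : IntegrableOn (fun s : ℝ => s ^ (3 + a)) (Set.Ioo 0 1) := by
    have := intervalIntegral.intervalIntegrable_rpow' (r := 3 + a) (a := 0) (b := 1) (by linarith)
    rw [intervalIntegrable_iff_integrableOn_Ioo_of_le zero_le_one] at this
    exact this
  refine h1.congr_fun (fun s hs => ?_) measurableSet_Ioo
  simp only [finrank_euclideanSpace, Fintype.card_fin, smul_eq_mul]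
  rw [Real.rpow_add hs.1]
  norm_num

/-- Within distance `1` of `x`, `f` is bounded and `|y|⁻²` is integrable in dimension four; farther
away the quotient is at most `|f|`. -/
lemma integrable_div_norm_sq {f : R4 → ℝ} (hf : Continuous f) (hfi : Integrable f) (x : R4) :
    Integrable fun y => f y / ‖x - y‖ ^ 2 := by
  obtain ⟨C, hC⟩ := (isCompact_closedBall x 1).exists_bound_of_continuousOn hf.continuousOn
  have h1 : Integrable ((Metric.ball (0 : R4) 1).indicator fun y : R4 => ‖y‖ ^ (-2 : ℝ)) :=
    (integrable_indicator_iff measurableSet_ball).2 (integrableOn_rpow_norm_ball (by norm_num))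
  have h2 := (h1.comp_sub_left x).const_mul C
  refine (hfi.norm.add h2).mono' ?_ (Eventually.of_forall fun y => ?_)
  · exact (hf.measurable.div (by fun_prop)).aestronglyMeasurable
  · rw [norm_div, norm_pow, norm_norm]
    simp only [Pi.add_apply]
    by_cases hy : ‖x - y‖ < 1
    · have hm : x - y ∈ Metric.ball (0 : R4) 1 := by simpa using hy
      rw [Set.indicator_of_mem hm, Real.rpow_neg (norm_nonneg _), div_eq_mul_inv]
      have := hC y (by rw [Metric.mem_closedBall, dist_comm, dist_eq_norm]; exact hy.le)
      have h3 : (‖x - y‖ ^ (2 : ℝ)) = ‖x - y‖ ^ 2 := by norm_cast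
      rw [h3]
      have : ‖f y‖ * (‖x - y‖ ^ 2)⁻¹ ≤ C * (‖x - y‖ ^ 2)⁻¹ := by gcongr
      linarith [norm_nonneg (f y)]
    · have hm : x - y ∉ Metric.ball (0 : R4) 1 := by simpa using hy
      rw [Set.indicator_of_notMem hm]
      simp only [mul_zero, add_zero]
      exact div_le_self (norm_nonneg _) (one_le_pow₀ (not_lt.1 hy))

lemma integrable_translate_div_norm_sq {f : R4 → ℝ} (hf : Continuous f) (hfi : Integrable f)
    (x : R4) : Integrable fun y => f (x + y) / ‖y‖ ^ 2 := by
  simpa using (integrable_div_norm_sq hf hfi x).comp_add_left x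

lemma integral_translate_div_norm_sq (f : R4 → ℝ) (x : R4) :
    ∫ y, f (x + y) / ‖y‖ ^ 2 = ∫ y, f y / ‖x - y‖ ^ 2 := by
  rw [← integral_add_left_eq_self (fun y => f y / ‖x - y‖ ^ 2) x]
  simp

/-! ### Green's representation for the Laplacian -/

lemma wmean_zero (k : ℕ) (w : R4 → ℝ) (x : R4) : wmean k w x 0 = w x * ∫ y, bump k y := by
  simp [wmean, integral_const_mul]

lemma integral_mul_bump_inv_smul (k : ℕ) (w : R4 → ℝ) (x : R4) {r : ℝ} (hr : 0 < r) :
    ∫ y, w (x + y) * bump k (r⁻¹ • y) = r ^ 4 * wmean k w x r := by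
  have h := Measure.integral_comp_smul (volume : Measure R4)
    (fun y => w (x + y) * bump k (r⁻¹ • y)) r
  have h1 : (fun y : R4 => w (x + r • y) * bump k (r⁻¹ • r • y)) =
      fun y => w (x + r • y) * bump k y := by
    ext y
    rw [smul_smul, inv_mul_cancel₀ hr.ne', one_smul]
  rw [h1] at h
  unfold wmean
  rw [h, finrank_euclideanSpace, Fintype.card_fin, abs_of_pos (by positivity), smul_eq_mul]
  field_simp

lemma hasDerivAt_bump_inv_smul {k : ℕ} (hk : k ≠ 0) (y : R4) {r : ℝ} (hr : 0 < r) :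
    HasDerivAt (fun r : ℝ => bump (k + 1) (r⁻¹ • y))
      (2 * (k + 1) * ‖y‖ ^ 2 / r ^ 3 * bump k (r⁻¹ • y)) r := by
  have h1 : HasDerivAt (fun r : ℝ => r⁻¹ • y) ((-(r ^ 2)⁻¹) • y) r :=
    (hasDerivAt_inv hr.ne').smul_const y
  have h2 := (hasFDerivAt_bump hk (r⁻¹ • y)).comp_hasDerivAt r h1
  refine h2.congr_deriv ?_
  simp [inner_smul_right]
  field_simp

lemma continuous_bump_inv_smul (k : ℕ) (r : ℝ) : Continuous fun y : R4 => bump k (r⁻¹ • y) :=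
  (continuous_bump k).comp (continuous_const_smul _)

/-- The derivative in `r` of the rescaled weight carries a factor `|y|²`, which cancels the kernel
and leaves a weighted mean of `G`. -/
lemma hasDerivAt_integral_bump_div_norm_sq {k : ℕ} (hk : k ≠ 0) {G : R4 → ℝ} (hG : Continuous G)
    (hGi : Integrable G) (x : R4) {r : ℝ} (hr : 0 < r) :
    HasDerivAt (fun r : ℝ => ∫ y, bump (k + 1) (r⁻¹ • y) * (G (x + y) / ‖y‖ ^ 2))
      (2 * (k + 1) * r * wmean k G x r) r := by
  have hI := integrable_translate_div_norm_sq hG hGi x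
  have hm : ∀ s : ℝ, AEStronglyMeasurable
      (fun y : R4 => bump (k + 1) (s⁻¹ • y) * (G (x + y) / ‖y‖ ^ 2)) volume := fun s =>
    (continuous_bump_inv_smul (k + 1) s).aestronglyMeasurable.mul hI.1
  have hD := (hasDerivAt_integral_of_dominated_loc_of_deriv_le (μ := (volume : Measure R4))
    (F := fun s y => bump (k + 1) (s⁻¹ • y) * (G (x + y) / ‖y‖ ^ 2))
    (F' := fun s y => 2 * (k + 1) / s ^ 3 * (G (x + y) * bump k (s⁻¹ • y)))
    -- The factor `1/s³` is bounded by restricting to `s > r/2`.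
    (bound := fun y => 2 * (k + 1) / (r / 2) ^ 3 * ‖G (x + y)‖)
    (Ioi_mem_nhds (half_lt_self hr)) (Eventually.of_forall hm) ?_ ?_ ?_ ?_ ?_).2
  · refine hD.congr_deriv ?_
    rw [integral_const_mul, integral_mul_bump_inv_smul k G x hr]
    field_simp
  · refine hI.norm.mono' (hm r) (Eventually.of_forall fun y => ?_)
    rw [norm_mul, Real.norm_of_nonneg (bump_nonneg _ _)]
    exact mul_le_of_le_one_left (norm_nonneg _) (bump_le_one _ _)
  · exact (((hG.comp (by fun_prop)).mul (continuous_bump_inv_smul k r)).const_mul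
      _).aestronglyMeasurable
  · refine Eventually.of_forall fun y s hs => ?_
    have hs : r / 2 < s := hs
    have hs0 : 0 < s := by linarith
    rw [norm_mul, norm_mul, Real.norm_of_nonneg (bump_nonneg _ _),
      Real.norm_of_nonneg (by positivity)]
    have : ‖G (x + y)‖ * bump k (s⁻¹ • y) ≤ ‖G (x + y)‖ :=
      mul_le_of_le_one_right (norm_nonneg _) (bump_le_one _ _)
    have h0 : 0 ≤ ‖G (x + y)‖ * bump k (s⁻¹ • y) := mul_nonneg (norm_nonneg _) (bump_nonneg _ _)
    gcongr
  · exact (hGi.comp_add_left x).norm.const_mul _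
  · have h0 : ∀ᵐ y : R4 ∂volume, y ≠ 0 := Measure.ae_ne volume 0
    filter_upwards [h0] with y hy s hs
    have hs : r / 2 < s := hs
    have hs0 : 0 < s := by linarith
    have hn : ‖y‖ ≠ 0 := norm_ne_zero_iff.2 hy
    refine ((hasDerivAt_bump_inv_smul hk y hs0).mul_const (G (x + y) / ‖y‖ ^ 2)).congr_deriv ?_
    field_simp

lemma eq_of_hasDerivAt_zero_of_tendsto {E : ℝ → ℝ} {c : ℝ}
    (hE : ∀ r, 0 < r → HasDerivAt E 0 r) (hc : Tendsto E (𝓝[>] 0) (𝓝 c)) {r : ℝ} (hr : 0 < r) :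
    E r = c := by
  have h : ∀ s ∈ Set.Ioi (0 : ℝ), E s = E r := fun s hs =>
    isOpen_Ioi.is_const_of_deriv_eq_zero isPreconnected_Ioi
      (fun t ht => (hE t ht).differentiableAt.differentiableWithinAt)
      (fun t ht => (hE t ht).deriv) hs hr
  refine tendsto_nhds_unique (tendsto_const_nhds.congr' ?_) hc
  filter_upwards [self_mem_nhdsWithin] with s hs using (h s hs).symm

lemma tendsto_bump_inv_smul_zero {k : ℕ} (hk : k ≠ 0) {y : R4} (hy : y ≠ 0) :
    Tendsto (fun r : ℝ => bump k (r⁻¹ • y)) (𝓝[>] 0) (𝓝 0) := by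
  refine tendsto_const_nhds.congr' ?_
  filter_upwards [Ioo_mem_nhdsGT (norm_pos_iff.2 hy)] with r hr
  refine (bump_eq_zero hk ?_).symm
  rw [norm_smul, norm_inv, Real.norm_of_nonneg hr.1.le, ← div_eq_inv_mul, one_le_div hr.1]
  exact hr.2.le

lemma tendsto_integral_bump_mul {l : Filter ℝ} [l.IsCountablyGenerated] {k : ℕ} {h : R4 → ℝ}
    (hh : Integrable h) {c : ℝ}
    (hl : ∀ y : R4, y ≠ 0 → Tendsto (fun r : ℝ => bump k (r⁻¹ • y)) l (𝓝 c)) :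
    Tendsto (fun r : ℝ => ∫ y, bump k (r⁻¹ • y) * h y) l (𝓝 (c * ∫ y, h y)) := by
  rw [← integral_const_mul]
  refine tendsto_integral_filter_of_dominated_convergence (fun y => ‖h y‖)
    (Eventually.of_forall fun r =>
      (continuous_bump_inv_smul k r).aestronglyMeasurable.mul hh.1)
    (Eventually.of_forall fun r => Eventually.of_forall fun y => ?_) hh.norm ?_
  · rw [norm_mul, Real.norm_of_nonneg (bump_nonneg _ _)]
    exact mul_le_of_le_one_left (norm_nonneg _) (bump_le_one _ _)
  · filter_upwards [Measure.ae_ne volume (0 : R4)] with y hy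
    exact (hl y hy).mul_const _

/-- Green's representation of a `C²` function by its weighted mean and its Laplacian. -/
lemma wmean_add_integral_eq {k : ℕ} (hk : k ≠ 0) {w G : R4 → ℝ} (hw : ContDiff ℝ 2 w)
    (hG : ∀ x, -(Δ w) x = G x) (hGi : Integrable G) (x : R4) {r : ℝ} (hr : 0 < r) :
    wmean k w x r + 1 / (4 * (k + 1) * (k + 2)) *
      ∫ y, bump (k + 2) (r⁻¹ • y) * (G (x + y) / ‖y‖ ^ 2) = w x * ∫ y, bump k y := by
  have hGe : G = fun x => -(Δ w) x := funext fun x => (hG x).symm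
  have hGc : Continuous G := hGe ▸ (continuous_laplacian hw).neg
  have hneg : ∀ r, wmean (k + 1) G x r = -wmean (k + 1) (Δ w) x r := by
    intro r
    simp [wmean, hGe, integral_neg]
  -- The coefficient is chosen so that both terms have derivative `± r/(2(k+1)) wmean (k+1) G`; the
  -- sum is then constant and equals its limit at `0`.
  refine eq_of_hasDerivAt_zero_of_tendsto (E := fun r => wmean k w x r +
    1 / (4 * (k + 1) * (k + 2)) *
      ∫ y, bump (k + 2) (r⁻¹ • y) * (G (x + y) / ‖y‖ ^ 2)) ?_ ?_ hr
  · intro s hs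
    have h1 := (hasDerivAt_wmean hk hw x s).add
      ((hasDerivAt_integral_bump_div_norm_sq (k := k + 1) (by omega) hGc hGi x hs).const_mul
        (1 / (4 * (k + 1) * (k + 2) : ℝ)))
    refine h1.congr_deriv ?_
    rw [hneg]
    push_cast
    field_simp
    ring
  · have h1 : Tendsto (wmean k w x) (𝓝[>] 0) (𝓝 (wmean k w x 0)) :=
      (hasDerivAt_wmean hk hw x 0).continuousAt.tendsto.mono_left nhdsWithin_le_nhds
    have h2 := (tendsto_integral_bump_mul (k := k + 2)
      (integrable_translate_div_norm_sq hGc hGi x)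
      (fun y hy => tendsto_bump_inv_smul_zero (by omega) hy)).const_mul
        (1 / (4 * (k + 1) * (k + 2) : ℝ))
    simpa [wmean_zero] using h1.add h2

/-! ### The logarithmic profile of the bilaplacian -/

/-- The radial profile with `Q' = 1 - (1 - 1/τ)₊⁴` and `Q 0 = 0`. -/
noncomputable def logProfile (τ : ℝ) : ℝ :=
  if τ ≤ 1 then τ else 4 * Real.log τ + 6 / τ - 2 / τ ^ 2 + 1 / (3 * τ ^ 3) - 10 / 3

lemma logProfile_of_le {τ : ℝ} (h : τ ≤ 1) : logProfile τ = τ := if_pos h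

lemma logProfile_of_ge {τ : ℝ} (h : 1 ≤ τ) :
    logProfile τ = 4 * Real.log τ + 6 / τ - 2 / τ ^ 2 + 1 / (3 * τ ^ 3) - 10 / 3 := by
  rcases h.eq_or_lt with rfl | h
  · rw [logProfile_of_le le_rfl]; norm_num
  · exact if_neg (not_le.2 h)

lemma hasDerivAt_logProfile_explicit {τ : ℝ} (h : 0 < τ) :
    HasDerivAt (fun τ : ℝ => 4 * Real.log τ + 6 / τ - 2 / τ ^ 2 + 1 / (3 * τ ^ 3) - 10 / 3)
      (1 - (1 - 1 / τ) ^ 4) τ := by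
  have h1 := (Real.hasDerivAt_log h.ne').const_mul 4
  have h2 := (hasDerivAt_const τ (6 : ℝ)).div (hasDerivAt_id τ) h.ne'
  have h3 := (hasDerivAt_const τ (2 : ℝ)).div (hasDerivAt_pow 2 τ) (by positivity)
  have h4 := (hasDerivAt_const τ (1 : ℝ)).div ((hasDerivAt_pow 3 τ).const_mul 3) (by positivity)
  refine ((((h1.add h2).sub h3).add h4).sub_const (10 / 3)).congr_deriv ?_
  simp
  field_simp
  ring

lemma hasDerivAt_logProfile {τ : ℝ} (h : 0 < τ) :
    HasDerivAt logProfile (1 - (max 0 (1 - 1 / τ)) ^ 4) τ := by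
  rcases lt_trichotomy τ 1 with h1 | h1 | h1
  · have : 1 - 1 / τ ≤ 0 := by
      rw [sub_nonpos, le_div_iff₀ h]; linarith
    rw [max_eq_left this]
    norm_num
    refine (hasDerivAt_id τ).congr_of_eventuallyEq ?_
    filter_upwards [Iio_mem_nhds h1] with t ht using logProfile_of_le (le_of_lt ht)
  · subst h1
    have ha : HasDerivWithinAt logProfile 1 (Set.Iic 1) 1 :=
      (hasDerivAt_id (1 : ℝ)).hasDerivWithinAt.congr (fun t ht => logProfile_of_le ht)
        (logProfile_of_le le_rfl)
    have hb : HasDerivWithinAt logProfile 1 (Set.Ici 1) 1 := by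
      have := (hasDerivAt_logProfile_explicit one_pos).hasDerivWithinAt (s := Set.Ici 1)
      have h0 : (1 : ℝ) - (1 - 1 / 1) ^ 4 = 1 := by norm_num
      rw [h0] at this
      exact this.congr (fun t ht => logProfile_of_ge ht) (logProfile_of_ge le_rfl)
    have := ha.union hb
    rw [Set.Iic_union_Ici, hasDerivWithinAt_univ] at this
    simpa using this
  · have : 0 ≤ 1 - 1 / τ := by
      rw [sub_nonneg, div_le_iff₀ h]; linarith
    rw [max_eq_right this]
    refine (hasDerivAt_logProfile_explicit h).congr_of_eventuallyEq ?_
    filter_upwards [Ioi_mem_nhds h1] with t ht using logProfile_of_ge (le_of_lt ht)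

lemma max_one_sub_inv_mem {τ : ℝ} (h : 0 < τ) :
    0 ≤ max 0 (1 - 1 / τ) ∧ max 0 (1 - 1 / τ) ≤ 1 :=
  ⟨le_max_left _ _, max_le zero_le_one (by have : 0 < 1 / τ := by positivity
                                           linarith)⟩

lemma logProfile_monotoneOn : MonotoneOn logProfile (Set.Ioi 0) := by
  refine monotoneOn_of_deriv_nonneg (convex_Ioi 0)
    (fun t ht => (hasDerivAt_logProfile ht).continuousAt.continuousWithinAt)
    (fun t ht => (hasDerivAt_logProfile (interior_subset ht)).differentiableAt.differentiableWithinAt)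
    fun t ht => ?_
  rw [(hasDerivAt_logProfile (interior_subset ht)).deriv, sub_nonneg]
  obtain ⟨h1, h2⟩ := max_one_sub_inv_mem (interior_subset ht)
  exact pow_le_one₀ h1 h2

/-- Together with monotonicity of `logProfile`, this says `0 ≤ Q' ≤ 4/τ`: increments of `Q` are
dominated by those of `4 log`, uniformly in scale. -/
lemma four_log_sub_logProfile_monotoneOn :
    MonotoneOn (fun τ => 4 * Real.log τ - logProfile τ) (Set.Ioi 0) := by
  have hd : ∀ t : ℝ, 0 < t → HasDerivAt (fun τ => 4 * Real.log τ - logProfile τ)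
      (4 * t⁻¹ - (1 - (max 0 (1 - 1 / t)) ^ 4)) t := fun t ht =>
    ((Real.hasDerivAt_log ht.ne').const_mul 4).sub (hasDerivAt_logProfile ht)
  refine monotoneOn_of_deriv_nonneg (convex_Ioi 0)
    (fun t ht => (hd t ht).continuousAt.continuousWithinAt)
    (fun t ht => (hd t (interior_subset ht)).differentiableAt.differentiableWithinAt)
    fun t ht => ?_
  rw [(hd t (interior_subset ht)).deriv]
  obtain ⟨h1, h2⟩ := max_one_sub_inv_mem (interior_subset ht)
  have h3 : 1 - 1 / t ≤ max 0 (1 - 1 / t) := le_max_right _ _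
  rw [← one_div]
  generalize max 0 (1 - 1 / t) = m at *
  -- The difference of the two sides is `(1 - m)² (m² + 2m + 3)`.
  have : 1 - m ^ 4 ≤ 4 * (1 - m) := by
    nlinarith [mul_nonneg (sq_nonneg (1 - m)) (by positivity : 0 ≤ m ^ 2 + 2 * m + 3)]
  linarith

lemma abs_logProfile_sub_le {a b : ℝ} (ha : 0 < a) (hb : 0 < b) :
    |logProfile a - logProfile b| ≤ 4 * |Real.log a - Real.log b| := by
  wlog h : b ≤ a generalizing a b
  · rw [abs_sub_comm, abs_sub_comm (Real.log a)]
    exact this hb ha (not_le.1 h).le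
  have h1 := logProfile_monotoneOn hb ha h
  have h2 := four_log_sub_logProfile_monotoneOn hb ha h
  have h3 := Real.log_le_log hb h
  simp only at h2
  rw [abs_of_nonneg (by linarith), abs_of_nonneg (by linarith)]
  linarith

lemma logProfile_nonneg {τ : ℝ} (h : 0 ≤ τ) : 0 ≤ logProfile τ := by
  rcases le_total τ 1 with h1 | h1
  · rwa [logProfile_of_le h1]
  · have := logProfile_monotoneOn (a := 1) (Set.mem_Ioi.2 one_pos)
      (Set.mem_Ioi.2 (by linarith)) h1
    rw [logProfile_of_le le_rfl] at this
    linarith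

lemma logProfile_le_log {τ : ℝ} (h : 1 ≤ τ) : logProfile τ ≤ 4 * Real.log τ + 3 := by
  rw [logProfile_of_ge h]
  have h1 : 6 / τ ≤ 6 := div_le_self (by norm_num) h
  have h2 : 1 / (3 * τ ^ 3) ≤ 1 / 3 := by
    have : 1 ≤ τ ^ 3 := one_le_pow₀ h
    gcongr
    linarith
  have h3 : 0 ≤ 2 / τ ^ 2 := by positivity
  linarith

/-- With `τ = r²/|y|²` the bound is linear in `r`, which supplies the dominating function for the
`o(r)` estimate. -/
lemma logProfile_le_sqrt {τ : ℝ} (h : 0 ≤ τ) : logProfile τ ≤ 11 * √τ := by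
  rcases le_total τ 1 with h1 | h1
  · rw [logProfile_of_le h1]
    have := Real.sqrt_nonneg τ
    have h2 := Real.sq_sqrt h
    have h3 := Real.sqrt_le_one.2 h1
    nlinarith
  · have h2 := logProfile_le_log h1
    have h3 : 1 ≤ √τ := Real.one_le_sqrt.2 h1
    have h4 : Real.log τ ≤ 2 * √τ := by
      rw [← Real.sq_sqrt h, Real.log_pow, Real.sqrt_sq (by positivity)]
      have := Real.log_le_sub_one_of_pos (show 0 < √τ by linarith)
      push_cast
      linarith
    linarith

lemma logProfile_le_self {τ : ℝ} (h : 0 < τ) : logProfile τ ≤ τ := by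
  rcases le_total τ 1 with h1 | h1
  · rw [logProfile_of_le h1]
  · have hd : ∀ t : ℝ, 0 < t → HasDerivAt (fun τ => τ - logProfile τ)
      (1 - (1 - (max 0 (1 - 1 / t)) ^ 4)) t := fun t ht =>
      (hasDerivAt_id t).sub (hasDerivAt_logProfile ht)
    have hm : MonotoneOn (fun τ => τ - logProfile τ) (Set.Ioi 0) := by
      refine monotoneOn_of_deriv_nonneg (convex_Ioi 0)
        (fun t ht => (hd t ht).continuousAt.continuousWithinAt)
        (fun t ht => (hd t (interior_subset ht)).differentiableAt.differentiableWithinAt)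
        fun t ht => ?_
      rw [(hd t (interior_subset ht)).deriv]
      have : 0 ≤ (max 0 (1 - 1 / t)) ^ 4 := by positivity
      linarith
    have := hm (a := 1) (Set.mem_Ioi.2 one_pos) h h1
    simp only [logProfile_of_le le_rfl] at this
    linarith

lemma tendsto_logProfile_sub_log :
    Tendsto (fun τ => logProfile τ - 4 * Real.log τ) atTop (𝓝 (-(10 / 3))) := by
  have h1 : Tendsto (fun τ : ℝ => 6 * τ⁻¹ - 2 * τ⁻¹ ^ 2 + 1 / 3 * τ⁻¹ ^ 3 - 10 / 3) atTop
      (𝓝 (6 * 0 - 2 * 0 ^ 2 + 1 / 3 * 0 ^ 3 - 10 / 3)) := by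
    have h := tendsto_inv_atTop_zero (𝕜 := ℝ)
    exact (((h.const_mul 6).sub ((h.pow 2).const_mul 2)).add ((h.pow 3).const_mul _)).sub_const _
  norm_num at h1
  refine (h1.congr' ?_)
  filter_upwards [eventually_ge_atTop 1] with τ hτ
  rw [logProfile_of_ge hτ]
  field_simp
  ring

/-- The additive constant `-10/3` in the expansion of `Q` cancels in the difference. -/
lemma tendsto_logProfile_sub {a b : ℝ} (ha : 0 < a) (hb : 0 < b) :
    Tendsto (fun t => logProfile (t * a) - logProfile (t * b)) atTop
      (𝓝 (4 * (Real.log a - Real.log b))) := by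
  have h1 := tendsto_logProfile_sub_log.comp (tendsto_id.atTop_mul_const ha)
  have h2 := tendsto_logProfile_sub_log.comp (tendsto_id.atTop_mul_const hb)
  have h3 := (h1.sub h2).add_const (4 * (Real.log a - Real.log b))
  rw [sub_self, zero_add] at h3
  refine h3.congr' ?_
  filter_upwards [eventually_gt_atTop 0] with t ht
  simp only [Function.comp, id]
  rw [Real.log_mul ht.ne' ha.ne', Real.log_mul ht.ne' hb.ne']
  ring

lemma measurable_logProfile : Measurable logProfile :=
  Measurable.ite measurableSet_Iic measurable_id (by fun_prop)

/-! ### Green's representation for the bilaplacian -/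

lemma bump_four_inv_smul_eq {y : R4} (hy : y ≠ 0) {r : ℝ} (hr : 0 < r) :
    (max 0 (1 - 1 / (r ^ 2 / ‖y‖ ^ 2))) ^ 4 = bump 4 (r⁻¹ • y) := by
  have hn : ‖y‖ ≠ 0 := norm_ne_zero_iff.2 hy
  unfold bump
  rw [norm_smul, norm_inv, Real.norm_of_nonneg hr.le]
  congr 3
  field_simp

lemma aestronglyMeasurable_logProfile_mul {f : R4 → ℝ} (hf : Continuous f) (x : R4)
    (r : ℝ) :
    AEStronglyMeasurable (fun y => logProfile (r ^ 2 / ‖y‖ ^ 2) * f (x + y)) volume :=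
  ((measurable_logProfile.comp (by fun_prop)).mul
    (hf.measurable.comp (by fun_prop))).aestronglyMeasurable

lemma norm_logProfile_mul_le (f : R4 → ℝ) (x : R4)
    {y : R4} (hy : y ≠ 0) {r : ℝ} (hr : 0 < r) :
    ‖logProfile (r ^ 2 / ‖y‖ ^ 2) * f (x + y)‖ ≤ r ^ 2 * ‖f (x + y) / ‖y‖ ^ 2‖ := by
  have hn : 0 < ‖y‖ := norm_pos_iff.2 hy
  have hp : 0 < r ^ 2 / ‖y‖ ^ 2 := by positivity
  rw [norm_mul, norm_div, Real.norm_of_nonneg (logProfile_nonneg hp.le),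
    Real.norm_of_nonneg (show 0 ≤ ‖y‖ ^ 2 by positivity)]
  calc _ ≤ r ^ 2 / ‖y‖ ^ 2 * ‖f (x + y)‖ := by gcongr; exact logProfile_le_self hp
    _ = _ := by ring

lemma integrable_logProfile_mul {f : R4 → ℝ} (hf : Continuous f) (hfi : Integrable f) (x : R4)
    {r : ℝ} (hr : 0 < r) :
    Integrable fun y => logProfile (r ^ 2 / ‖y‖ ^ 2) * f (x + y) := by
  refine ((integrable_translate_div_norm_sq hf hfi x).norm.const_mul (r ^ 2)).mono'
    (aestronglyMeasurable_logProfile_mul hf x r) ?_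
  filter_upwards [Measure.ae_ne volume (0 : R4)] with y hy
  exact norm_logProfile_mul_le f x hy hr

/-- The chain rule gives `(2r/|y|²) Q'(r²/|y|²)`, and `Q'` was chosen so that this is `2r (1 - bump
4 (y/r))/|y|²`. -/
lemma hasDerivAt_integral_logProfile {f : R4 → ℝ} (hf : Continuous f) (hfi : Integrable f) (x : R4)
    {r : ℝ} (hr : 0 < r) :
    HasDerivAt (fun r : ℝ => ∫ y, logProfile (r ^ 2 / ‖y‖ ^ 2) * f (x + y))
      (2 * r * ((∫ y, f (x + y) / ‖y‖ ^ 2) -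
        ∫ y, bump 4 (r⁻¹ • y) * (f (x + y) / ‖y‖ ^ 2))) r := by
  have hI := integrable_translate_div_norm_sq hf hfi x
  have hb : ∀ s : ℝ, Integrable fun y : R4 => bump 4 (s⁻¹ • y) * (f (x + y) / ‖y‖ ^ 2) := by
    intro s
    refine hI.norm.mono' ((continuous_bump_inv_smul 4 s).aestronglyMeasurable.mul hI.1)
      (Eventually.of_forall fun y => ?_)
    rw [norm_mul, Real.norm_of_nonneg (bump_nonneg _ _)]
    exact mul_le_of_le_one_left (norm_nonneg _) (bump_le_one _ _)
  have hD := (hasDerivAt_integral_of_dominated_loc_of_deriv_le (μ := (volume : Measure R4))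
    (F := fun s y => logProfile (s ^ 2 / ‖y‖ ^ 2) * f (x + y))
    (F' := fun s y => 2 * s * (f (x + y) / ‖y‖ ^ 2 - bump 4 (s⁻¹ • y) * (f (x + y) / ‖y‖ ^ 2)))
    (bound := fun y => 2 * (2 * r) * ‖f (x + y) / ‖y‖ ^ 2‖)
    (Ioo_mem_nhds (half_lt_self hr) (show r < 2 * r by linarith))
    (Eventually.of_forall (aestronglyMeasurable_logProfile_mul hf x))
    (integrable_logProfile_mul hf hfi x hr) ((hI.sub (hb r)).const_mul _).1
    (Eventually.of_forall fun y s hs => ?_) (hI.norm.const_mul _) ?_).2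
  · refine hD.congr_deriv ?_
    rw [integral_const_mul, integral_sub hI (hb r)]
  · have hs0 : 0 < s := by linarith [hs.1]
    have h1 : f (x + y) / ‖y‖ ^ 2 - bump 4 (s⁻¹ • y) * (f (x + y) / ‖y‖ ^ 2) =
        (1 - bump 4 (s⁻¹ • y)) * (f (x + y) / ‖y‖ ^ 2) := by ring
    have h2 := bump_nonneg 4 (s⁻¹ • y)
    have h3 := bump_le_one 4 (s⁻¹ • y)
    rw [h1, norm_mul, norm_mul (1 - bump 4 (s⁻¹ • y)), Real.norm_of_nonneg (by positivity),
      Real.norm_of_nonneg (by linarith)]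
    have h4 : (1 - bump 4 (s⁻¹ • y)) * ‖f (x + y) / ‖y‖ ^ 2‖ ≤ ‖f (x + y) / ‖y‖ ^ 2‖ :=
      mul_le_of_le_one_left (norm_nonneg _) (by linarith)
    have := hs.2.le
    gcongr
  · filter_upwards [Measure.ae_ne volume (0 : R4)] with y hy s hs
    have hs0 : 0 < s := by linarith [hs.1]
    have hn : ‖y‖ ≠ 0 := norm_ne_zero_iff.2 hy
    have h1 : HasDerivAt (fun s : ℝ => s ^ 2 / ‖y‖ ^ 2) (2 * s / ‖y‖ ^ 2) s := by
      simpa using (hasDerivAt_pow 2 s).div_const (‖y‖ ^ 2)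
    have h2 := ((hasDerivAt_logProfile (show 0 < s ^ 2 / ‖y‖ ^ 2 by positivity)).comp s
      h1).mul_const (f (x + y))
    refine h2.congr_deriv ?_
    rw [bump_four_inv_smul_eq hy hs0]
    ring

lemma tendsto_integral_logProfile_zero {f : R4 → ℝ} (hf : Continuous f) (hfi : Integrable f) (x : R4) :
    Tendsto (fun r : ℝ => ∫ y, logProfile (r ^ 2 / ‖y‖ ^ 2) * f (x + y)) (𝓝[>] 0) (𝓝 0) := by
  have hI := integrable_translate_div_norm_sq hf hfi x
  have h1 : Tendsto (fun r : ℝ => r ^ 2 * ∫ y, ‖f (x + y) / ‖y‖ ^ 2‖) (𝓝[>] 0) (𝓝 0) := by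
    have h : Tendsto (fun r : ℝ => r ^ 2 * ∫ y, ‖f (x + y) / ‖y‖ ^ 2‖) (𝓝 0)
        (𝓝 (0 ^ 2 * ∫ y, ‖f (x + y) / ‖y‖ ^ 2‖)) :=
      ((continuous_pow 2).mul continuous_const).tendsto 0
    simp only [ne_eq, OfNat.ofNat_ne_zero, not_false_eq_true, zero_pow, zero_mul] at h
    exact h.mono_left nhdsWithin_le_nhds
  refine squeeze_zero_norm' ?_ h1
  filter_upwards [self_mem_nhdsWithin] with r hr
  rw [← integral_const_mul]
  refine norm_integral_le_of_norm_le (hI.norm.const_mul _) ?_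
  filter_upwards [Measure.ae_ne volume (0 : R4)] with y hy
  exact norm_logProfile_mul_le f x hy hr

/-- `∫ Q(r²/|y|²) f(x+y) dy = o(r)`. -/
lemma tendsto_integral_logProfile_div {f : R4 → ℝ} (hf : Continuous f) (hfi : Integrable f) (x : R4) :
    Tendsto (fun r : ℝ => (∫ y, logProfile (r ^ 2 / ‖y‖ ^ 2) * f (x + y)) / r) atTop (𝓝 0) := by
  have hI := integrable_translate_div_norm_sq hf hfi x
  simp_rw [← integral_div]
  rw [← integral_zero R4 ℝ]
  refine tendsto_integral_filter_of_dominated_convergence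
    (fun y => 11 * (‖f (x + y)‖ + ‖f (x + y) / ‖y‖ ^ 2‖))
    (Eventually.of_forall fun r => by
      simpa only [div_eq_mul_inv] using
        (aestronglyMeasurable_logProfile_mul hf x r).mul_const r⁻¹)
    ?_ (((hfi.comp_add_left x).norm.add hI.norm).const_mul 11) ?_
  · filter_upwards [eventually_gt_atTop 0] with r hr
    filter_upwards [Measure.ae_ne volume (0 : R4)] with y hy
    have hn : 0 < ‖y‖ := norm_pos_iff.2 hy
    have hp : 0 < r ^ 2 / ‖y‖ ^ 2 := by positivity
    -- After division by `r` the integrand is at most `11 |f|/|y|`, and `1/|y| ≤ 1 + 1/|y|²`.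
    have h1 := logProfile_le_sqrt hp.le
    rw [Real.sqrt_div (by positivity), Real.sqrt_sq hr.le, Real.sqrt_sq hn.le] at h1
    rw [norm_div, norm_mul, norm_div, Real.norm_of_nonneg (logProfile_nonneg hp.le),
      Real.norm_of_nonneg hr.le, Real.norm_of_nonneg (show 0 ≤ ‖y‖ ^ 2 by positivity),
      div_le_iff₀ hr]
    have h2 : 1 / ‖y‖ ≤ 1 + 1 / ‖y‖ ^ 2 := by
      have : 1 / ‖y‖ ^ 2 = (1 / ‖y‖) ^ 2 := by field_simp
      rw [this]
      nlinarith [sq_nonneg (1 / ‖y‖ - 1), sq_nonneg (1 / ‖y‖)]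
    calc logProfile (r ^ 2 / ‖y‖ ^ 2) * ‖f (x + y)‖ ≤ 11 * (r / ‖y‖) * ‖f (x + y)‖ := by gcongr
      _ = 11 * (‖f (x + y)‖ * (1 / ‖y‖)) * r := by ring
      _ ≤ 11 * (‖f (x + y)‖ * (1 + 1 / ‖y‖ ^ 2)) * r := by gcongr
      _ = _ := by ring
  · filter_upwards [Measure.ae_ne volume (0 : R4)] with y hy
    have hn : 0 < ‖y‖ := norm_pos_iff.2 hy
    have h1 : Tendsto (fun r : ℝ => (8 * (Real.log r / r) + (3 - 8 * Real.log ‖y‖) * r⁻¹)) atTop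
        (𝓝 0) := by
      have ha : Tendsto (fun r : ℝ => Real.log r / r) atTop (𝓝 0) :=
        Real.isLittleO_log_id_atTop.tendsto_div_nhds_zero
      simpa using (ha.const_mul 8).add (tendsto_inv_atTop_zero.const_mul (3 - 8 * Real.log ‖y‖))
    have h2 : Tendsto (fun r : ℝ => logProfile (r ^ 2 / ‖y‖ ^ 2) / r) atTop (𝓝 0) := by
      refine squeeze_zero' ?_ ?_ h1
      · filter_upwards [eventually_gt_atTop 0] with r hr
        exact div_nonneg (logProfile_nonneg (by positivity)) hr.le
      · filter_upwards [eventually_gt_atTop 0, eventually_ge_atTop ‖y‖] with r hr hry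
        have h3 := logProfile_le_log (τ := r ^ 2 / ‖y‖ ^ 2)
          (by rw [one_le_div (by positivity)]; gcongr)
        rw [Real.log_div (by positivity) (by positivity), Real.log_pow, Real.log_pow] at h3
        rw [div_le_iff₀ hr]
        push_cast at h3
        have : (8 * (Real.log r / r) + (3 - 8 * Real.log ‖y‖) * r⁻¹) * r =
          8 * Real.log r + (3 - 8 * Real.log ‖y‖) := by field_simp
        rw [this]
        linarith
    have h3 := h2.mul_const (f (x + y))
    rw [zero_mul] at h3
    exact h3.congr fun r => by ring

/-- Green's representation of a `C⁴` function by its weighted mean and its bilaplacian. -/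
lemma wmean_add_integral_logProfile_eq {f : R4 → ℝ} (hf : Continuous f) (hfi : Integrable f) (x : R4)
    {v : R4 → ℝ} (hv : ContDiff ℝ 4 v)
    (hΔ : ∀ x, -(Δ (-(Δ v))) x = f x) {r : ℝ} (hr : 0 < r) :
    wmean 1 v x r + 1 / 384 * (∫ y, logProfile (r ^ 2 / ‖y‖ ^ 2) * f (x + y)) +
      (-(Δ v) x * omega3 / 192 - (∫ y, f (x + y) / ‖y‖ ^ 2) / 384) * r ^ 2 =
      v x * (omega3 / 12) := by
  have hv2 : ContDiff ℝ 2 v := hv.of_le (by norm_num)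
  refine eq_of_hasDerivAt_zero_of_tendsto (E := fun r => wmean 1 v x r +
    1 / 384 * (∫ y, logProfile (r ^ 2 / ‖y‖ ^ 2) * f (x + y)) +
      (-(Δ v) x * omega3 / 192 - (∫ y, f (x + y) / ‖y‖ ^ 2) / 384) * r ^ 2) ?_ ?_ hr
  · intro s hs
    have h1 := ((hasDerivAt_wmean one_ne_zero hv2 x s).add
      ((hasDerivAt_integral_logProfile hf hfi x hs).const_mul (1 / 384 : ℝ))).add
      ((hasDerivAt_pow 2 s).const_mul
        (-(Δ v) x * omega3 / 192 - (∫ y, f (x + y) / ‖y‖ ^ 2) / 384))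
    refine h1.congr_deriv ?_
    -- The derivative of `wmean 1 v` involves `wmean 2 (Δ v)`; Green's formula for `-Δv` with `k =
    -- 2` brings in `bump 4`, matching the profile.
    have h2 := wmean_add_integral_eq (k := 2) two_ne_zero (contDiff_laplacian hv).neg hΔ hfi x hs
    have h3 : wmean 2 (fun x => -(Δ v) x) x s = -wmean 2 (Δ v) x s := by simp [wmean, integral_neg]
    rw [integral_bump_two] at h2
    rw [h3] at h2
    norm_num at h2 ⊢
    linear_combination (-s / 4) * h2
  · have h1 : Tendsto (wmean 1 v x) (𝓝[>] 0) (𝓝 (wmean 1 v x 0)) :=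
      (hasDerivAt_wmean one_ne_zero hv2 x 0).continuousAt.tendsto.mono_left nhdsWithin_le_nhds
    have h2 := (tendsto_integral_logProfile_zero hf hfi x).const_mul (1 / 384)
    have h3 : Tendsto (fun r : ℝ => (-(Δ v) x * omega3 / 192 -
        (∫ y, f (x + y) / ‖y‖ ^ 2) / 384) * r ^ 2) (𝓝[>] 0) (𝓝 ((-(Δ v) x * omega3 / 192 -
        (∫ y, f (x + y) / ‖y‖ ^ 2) / 384) * 0 ^ 2)) :=
      ((continuous_const.mul (continuous_pow 2)).tendsto 0).mono_left nhdsWithin_le_nhds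
    simpa [wmean_zero, integral_bump_one] using (h1.add h2).add h3

/-! ### Subquadratic growth and the formula for the Laplacian -/

lemma exists_abs_le_mul_norm_sq_add {v : R4 → ℝ} (hvc : Continuous v)
    (hv : v =o[cocompact R4] fun x => ‖x‖ ^ 2) {ε : ℝ} (hε : 0 < ε) :
    ∃ C, 0 ≤ C ∧ ∀ x, |v x| ≤ ε * ‖x‖ ^ 2 + C := by
  have h1 := hv.bound hε
  rw [← Metric.cobounded_eq_cocompact, (Metric.hasBasis_cobounded_compl_closedBall 0).eventually_iff]
    at h1
  obtain ⟨R, -, hR⟩ := h1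
  obtain ⟨C, hC⟩ := (isCompact_closedBall (0 : R4) R).exists_bound_of_continuousOn hvc.continuousOn
  refine ⟨max C 0, le_max_right _ _, fun x => ?_⟩
  by_cases hx : x ∈ Metric.closedBall (0 : R4) R
  · have h2 := hC x hx
    rw [Real.norm_eq_abs] at h2
    have : 0 ≤ ε * ‖x‖ ^ 2 := by positivity
    linarith [le_max_left C 0]
  · have h2 := hR hx
    rw [Real.norm_eq_abs, norm_pow, norm_norm] at h2
    linarith [le_max_right C 0]

lemma wmean_mono {k : ℕ} (hk : k ≠ 0) {w₁ w₂ : R4 → ℝ} (h₁ : Continuous w₁) (h₂ : Continuous w₂)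
    {x : R4} {r : ℝ} (h : ∀ y, ‖y‖ < 1 → w₁ (x + r • y) ≤ w₂ (x + r • y)) :
    wmean k w₁ x r ≤ wmean k w₂ x r := by
  refine integral_mono (integrable_mul_bump hk (h₁.comp (by fun_prop)))
    (integrable_mul_bump hk (h₂.comp (by fun_prop))) fun y => ?_
  by_cases hy : bump k y = 0
  · simp [hy]
  · exact mul_le_mul_of_nonneg_right (h y (norm_lt_one_of_bump_ne_zero hk hy)) (bump_nonneg k y)

lemma abs_wmean_le {k : ℕ} (hk : k ≠ 0) {w : R4 → ℝ} {x : R4} {r C : ℝ}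
    (h : ∀ y, ‖y‖ < 1 → |w (x + r • y)| ≤ C) : |wmean k w x r| ≤ C * ∫ y, bump k y := by
  rw [← integral_const_mul, ← Real.norm_eq_abs]
  refine norm_integral_le_of_norm_le ((integrable_bump hk).const_mul C)
    (Eventually.of_forall fun y => ?_)
  rw [norm_mul, Real.norm_of_nonneg (bump_nonneg k y), Real.norm_eq_abs]
  by_cases hy : bump k y = 0
  · simp [hy]
  · exact mul_le_mul_of_nonneg_right (h y (norm_lt_one_of_bump_ne_zero hk hy)) (bump_nonneg k y)

lemma tendsto_wmean_div_sq {v : R4 → ℝ} (hvc : Continuous v)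
    (hv : v =o[cocompact R4] fun x => ‖x‖ ^ 2) (x : R4) :
    Tendsto (fun r => wmean 1 v x r / r ^ 2) atTop (𝓝 0) := by
  have hω := omega3_pos
  refine IsLittleO.tendsto_div_nhds_zero (isLittleO_iff.2 fun c hc => ?_)
  -- On the averaging ball `|x + ry| ≤ 2r`, and the weight has mass `ω₃/12`; the coefficient
  -- `3c/(2ω₃)` makes the quadratic part exactly `c r²/2`.
  obtain ⟨C, hC0, hC⟩ := exists_abs_le_mul_norm_sq_add hvc hv
    (show 0 < c * (3 / (2 * omega3)) by positivity)
  have h1 : ∀ᶠ r : ℝ in atTop, C * (omega3 / 12) ≤ c / 2 * r ^ 2 :=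
    ((tendsto_pow_atTop two_ne_zero).const_mul_atTop (by positivity)).eventually_ge_atTop _
  filter_upwards [h1, eventually_ge_atTop ‖x‖, eventually_ge_atTop 0] with r hr hrx hr0
  have h2 := abs_wmean_le (k := 1) one_ne_zero (w := v) (x := x) (r := r)
    (C := c * (3 / (2 * omega3)) * (2 * r) ^ 2 + C) fun y hy => by
      refine (hC _).trans ?_
      have : ‖x + r • y‖ ≤ 2 * r := by
        refine (norm_add_le _ _).trans ?_
        rw [norm_smul, Real.norm_of_nonneg hr0]
        nlinarith
      gcongr
  rw [integral_bump_one] at h2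
  rw [Real.norm_eq_abs, Real.norm_of_nonneg (by positivity)]
  refine h2.trans ?_
  have : c * (3 / (2 * omega3)) * (2 * r) ^ 2 * (omega3 / 12) = c / 2 * r ^ 2 := by
    field_simp
    ring
  linarith

/-- The Laplacian of `v` is the Newtonian potential of its bilaplacian. -/
lemma laplacian_eq_newtonian {v f : R4 → ℝ} (hv : ContDiff ℝ 4 v)
    (hΔ : ∀ x, -(Δ (-(Δ v))) x = f x) (hf : Continuous f) (hfi : Integrable f)
    (hvo : v =o[cocompact R4] fun x => ‖x‖ ^ 2) (x : R4) :
    -(Δ v) x * omega3 / 192 - (∫ y, f (x + y) / ‖y‖ ^ 2) / 384 = 0 := by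
  set L := -(Δ v) x * omega3 / 192 - (∫ y, f (x + y) / ‖y‖ ^ 2) / 384 with hL
  have h1 := tendsto_wmean_div_sq hv.continuous hvo x
  have h2 := ((tendsto_integral_logProfile_div hf hfi x).mul tendsto_inv_atTop_zero).const_mul
    (1 / 384)
  have h3 := ((tendsto_pow_atTop (α := ℝ) two_ne_zero).inv_tendsto_atTop).const_mul
    (v x * (omega3 / 12))
  have h4 := (h1.add h2).sub h3
  -- Dividing Green's identity by `r²` expresses the constant `-L` through three terms that all
  -- vanish in the limit.
  have h5 : Tendsto (fun _ : ℝ => -L) atTop (𝓝 (0 + 1 / 384 * (0 * 0) - v x * (omega3 / 12) * 0)) := by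
    refine h4.congr' ?_
    filter_upwards [eventually_gt_atTop 0] with r hr
    have h6 := wmean_add_integral_logProfile_eq hf hfi x hv hΔ hr
    rw [← hL] at h6
    simp only [Pi.inv_apply]
    field_simp
    linear_combination 4608 * h6
  have h7 := tendsto_nhds_unique h5 tendsto_const_nhds
  norm_num at h7
  exact h7

lemma wmean_add_integral_logProfile_eq_of_isLittleO {v f : R4 → ℝ} (hv : ContDiff ℝ 4 v)
    (hΔ : ∀ x, -(Δ (-(Δ v))) x = f x) (hf : Continuous f) (hfi : Integrable f)
    (hvo : v =o[cocompact R4] fun x => ‖x‖ ^ 2) (x : R4) {r : ℝ} (hr : 0 < r) :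
    wmean 1 v x r + 1 / 384 * (∫ y, logProfile (r ^ 2 / ‖y‖ ^ 2) * f (x + y)) =
      v x * (omega3 / 12) := by
  have := wmean_add_integral_logProfile_eq hf hfi x hv hΔ hr
  rwa [laplacian_eq_newtonian hv hΔ hf hfi hvo x, zero_mul, add_zero] at this

/-! ### The logarithmic representation -/

lemma one_div_le_one_add {d : ℝ} (hd : 0 < d) : 1 / d ≤ 1 + 1 / d ^ 2 := by
  have : 1 / d ^ 2 = (1 / d) ^ 2 := by field_simp
  rw [this]
  nlinarith [sq_nonneg (1 / d - 1), sq_nonneg (1 / d)]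

lemma log_norm_sub_le (x : R4) {y : R4} (hy : y ≠ x) :
    Real.log ‖x - y‖ - Real.log (‖y‖ + 1) ≤ Real.log (‖x‖ + 1) := by
  have hd : 0 < ‖x - y‖ := norm_sub_pos_iff.2 hy.symm
  rw [sub_le_iff_le_add, ← Real.log_mul (by positivity) (by positivity)]
  refine Real.log_le_log hd ((norm_sub_le _ _).trans ?_)
  nlinarith [norm_nonneg x, norm_nonneg y, mul_nonneg (norm_nonneg x) (norm_nonneg y)]

/-- The logarithmic singularity is weaker than `1/d`, hence than `1 + 1/d²`, so integrability of the
kernel reduces to that of `f/|x-y|²`. -/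
lemma abs_log_norm_sub_le (x : R4) {y : R4} (hy : y ≠ x) :
    |Real.log ‖x - y‖ - Real.log (‖y‖ + 1)| ≤ (‖x‖ + 1) * (1 + 1 / ‖x - y‖ ^ 2) := by
  have hd : 0 < ‖x - y‖ := norm_sub_pos_iff.2 hy.symm
  have hx := norm_nonneg x
  rw [abs_le]
  constructor
  · have h1 : Real.log (‖y‖ + 1) - Real.log ‖x - y‖ ≤ (‖x‖ + 1) * (1 / ‖x - y‖) := by
      rw [← Real.log_div (by positivity) (by positivity)]
      have h2 : (‖y‖ + 1) / ‖x - y‖ ≤ 1 + (‖x‖ + 1) * (1 / ‖x - y‖) := by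
        have h3 : ‖y‖ ≤ ‖x‖ + ‖x - y‖ := norm_le_norm_add_norm_sub _ _
        rw [div_le_iff₀ hd, add_mul, mul_assoc, one_div, inv_mul_cancel₀ hd.ne']
        linarith
      refine (Real.log_le_log (by positivity) h2).trans ?_
      have := Real.log_le_sub_one_of_pos (show 0 < 1 + (‖x‖ + 1) * (1 / ‖x - y‖) by positivity)
      linarith
    have h4 : (‖x‖ + 1) * (1 / ‖x - y‖) ≤ (‖x‖ + 1) * (1 + 1 / ‖x - y‖ ^ 2) := by
      gcongr
      exact one_div_le_one_add hd
    linarith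
  · have h1 := log_norm_sub_le x hy
    have h2 := Real.log_le_sub_one_of_pos (show 0 < ‖x‖ + 1 by positivity)
    have : 0 ≤ 1 / ‖x - y‖ ^ 2 := by positivity
    nlinarith

lemma integrable_log_kernel {f : R4 → ℝ} (hf : Continuous f) (hfi : Integrable f) (x : R4) :
    Integrable fun y => (Real.log ‖x - y‖ - Real.log (‖y‖ + 1)) * f y := by
  refine ((hfi.norm.add (integrable_div_norm_sq hf hfi x).norm).const_mul (‖x‖ + 1)).mono'
    (Measurable.aestronglyMeasurable (by fun_prop)) ?_
  filter_upwards [Measure.ae_ne volume x] with y hy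
  rw [norm_mul, Real.norm_eq_abs]
  calc _ ≤ (‖x‖ + 1) * (1 + 1 / ‖x - y‖ ^ 2) * ‖f y‖ := by
        gcongr; exact abs_log_norm_sub_le x hy
    _ = _ := by simp; ring

lemma integrable_log_sub_log {f : R4 → ℝ} (hf : Continuous f) (hfi : Integrable f) (x x' : R4) :
    Integrable fun y => (Real.log ‖x - y‖ - Real.log ‖x' - y‖) * f y := by
  refine ((integrable_log_kernel hf hfi x).sub (integrable_log_kernel hf hfi x')).congr
    (Eventually.of_forall fun y => ?_)
  simp; ring

/-- A Lipschitz bound whose right side is again a weight, so that it integrates to a mean over a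
ball four times larger. If `|b| ≥ 2` both values vanish; otherwise `|a| + |b| ≤ 6` and the dilated
weight is at least `3/4`, whence `8 = 6/(3/4)`. -/
lemma abs_bump_one_sub_le {a b : R4} (h : ‖a - b‖ ≤ 1) :
    |bump 1 a - bump 1 b| ≤ 8 * ‖a - b‖ * bump 1 ((4 : ℝ)⁻¹ • b) := by
  by_cases hb : 2 ≤ ‖b‖
  · have ha : 1 ≤ ‖a‖ := by
      have := norm_le_norm_add_norm_sub a b
      linarith
    rw [bump_eq_zero one_ne_zero ha, bump_eq_zero one_ne_zero (by linarith), sub_self, abs_zero]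
    exact mul_nonneg (by positivity) (bump_nonneg _ _)
  · have hb := not_le.1 hb
    have ha : ‖a‖ ≤ 3 := by
      have := norm_le_norm_add_norm_sub b a
      rw [norm_sub_rev] at this
      linarith
    have h1 : 3 / 4 ≤ bump 1 ((4 : ℝ)⁻¹ • b) := by
      unfold bump
      rw [pow_one, norm_smul, norm_inv, Real.norm_of_nonneg (by norm_num)]
      refine le_max_of_le_right ?_
      nlinarith [norm_nonneg b]
    have h2 : |bump 1 a - bump 1 b| ≤ |(1 - ‖a‖ ^ 2) - (1 - ‖b‖ ^ 2)| := by
      unfold bump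
      rw [pow_one, pow_one, max_comm, max_comm (0 : ℝ)]
      exact abs_max_sub_max_le_abs _ _ _
    have h3 : |(1 - ‖a‖ ^ 2) - (1 - ‖b‖ ^ 2)| ≤ ‖a - b‖ * 6 := by
      have : (1 - ‖a‖ ^ 2) - (1 - ‖b‖ ^ 2) = (‖b‖ - ‖a‖) * (‖a‖ + ‖b‖) := by ring
      rw [this, abs_mul, abs_sub_comm, abs_of_nonneg (show 0 ≤ ‖a‖ + ‖b‖ by positivity)]
      have := abs_norm_sub_norm_le a b
      gcongr
      linarith
    have : 6 * ‖a - b‖ ≤ 8 * ‖a - b‖ * bump 1 ((4 : ℝ)⁻¹ • b) := by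
      nlinarith [norm_nonneg (a - b)]
    linarith

/-- Moving the centre from `0` to `x` shifts the rescaled weight by `|x|/r`, which gains a factor
`1/r`; thus sublinear means of `|v|` make the means at different centres asymptotically equal. The
constant is `8 · 4⁴ · 4`. -/
lemma abs_wmean_sub_le {v : R4 → ℝ} (hv : Continuous v) (x : R4) {r : ℝ} (hr : 0 < r) (hrx : ‖x‖ ≤ r) :
    |wmean 1 v x r - wmean 1 v 0 r| ≤
      8192 * ‖x‖ * (wmean 1 (fun y => |v y|) 0 (4 * r) / (4 * r)) := by
  have hi : ∀ z, Integrable fun y => v y * bump 1 (r⁻¹ • (y - z)) := by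
    intro z
    have h0 := (integrable_mul_bump (k := 1) one_ne_zero (h := fun y => v (z + r • y))
      (hv.comp (by fun_prop))).comp_smul (R := r⁻¹) (inv_ne_zero hr.ne')
    have h1 := h0.comp_sub_right z
    refine h1.congr (Eventually.of_forall fun y => ?_)
    simp [smul_smul, hr.ne']
  have e : ∀ z, r ^ 4 * wmean 1 v z r = ∫ y, v y * bump 1 (r⁻¹ • (y - z)) := by
    intro z
    rw [← integral_mul_bump_inv_smul 1 v z hr,
      ← integral_add_left_eq_self (fun y => v y * bump 1 (r⁻¹ • (y - z))) z]
    simp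
  have e4 := integral_mul_bump_inv_smul 1 (fun y => |v y|) 0 (show 0 < 4 * r by positivity)
  have hr4 : Integrable fun y => |v y| * bump 1 ((4 * r)⁻¹ • y) := by
    have h0 := (integrable_mul_bump (k := 1) one_ne_zero (h := fun y => |v ((4 * r) • y)|)
      ((hv.comp (by fun_prop)).abs)).comp_smul (R := (4 * r)⁻¹) (by positivity)
    refine h0.congr (Eventually.of_forall fun y => ?_)
    simp only
    rw [smul_smul, mul_inv_cancel₀ (by positivity), one_smul]
  have h1 : |r ^ 4 * wmean 1 v x r - r ^ 4 * wmean 1 v 0 r| ≤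
      8 * (‖x‖ / r) * ((4 * r) ^ 4 * wmean 1 (fun y => |v y|) 0 (4 * r)) := by
    rw [e, e, ← integral_sub (hi x) (hi 0), ← e4, ← integral_const_mul, ← Real.norm_eq_abs]
    simp only [zero_add]
    refine norm_integral_le_of_norm_le (hr4.const_mul _) (Eventually.of_forall fun y => ?_)
    have hab : r⁻¹ • (y - x) - r⁻¹ • (y - 0) = -(r⁻¹ • x) := by
      rw [← smul_sub]; simp
    have hn : ‖r⁻¹ • (y - x) - r⁻¹ • (y - 0)‖ = ‖x‖ / r := by
      rw [hab, norm_neg, norm_smul, norm_inv, Real.norm_of_nonneg hr.le]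
      field_simp
    have h2 := abs_bump_one_sub_le (a := r⁻¹ • (y - x)) (b := r⁻¹ • (y - 0))
      (by rw [hn, div_le_one hr]; exact hrx)
    rw [hn, smul_smul, ← mul_inv, sub_zero] at h2
    rw [← mul_sub, norm_mul, Real.norm_eq_abs, Real.norm_eq_abs, sub_zero]
    calc _ ≤ |v y| * (8 * (‖x‖ / r) * bump 1 ((4 * r)⁻¹ • y)) := by gcongr
      _ = _ := by ring
  rw [← mul_sub, abs_mul, abs_of_pos (show 0 < r ^ 4 by positivity)] at h1
  refine le_of_mul_le_mul_left (h1.trans_eq ?_) (show 0 < r ^ 4 by positivity)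
  field_simp
  ring

/-- Logarithmic representation of a biharmonic potential whose means are sublinear. -/
lemma sub_eq_integral_log {v f : R4 → ℝ} (hv : ContDiff ℝ 4 v)
    (hΔ : ∀ x, -(Δ (-(Δ v))) x = f x) (hf : Continuous f) (hfi : Integrable f)
    (hvo : v =o[cocompact R4] fun x => ‖x‖ ^ 2)
    (hmean : Tendsto (fun r => wmean 1 (fun y => |v y|) 0 r / r) atTop (𝓝 0)) (x : R4) :
    v x - v 0 = -(1 / (4 * omega3)) * ∫ y, (Real.log ‖x - y‖ - Real.log ‖0 - y‖) * f y := by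
  have hω := omega3_pos
  have h1 : Tendsto (fun r => wmean 1 v x r - wmean 1 v 0 r) atTop (𝓝 0) := by
    have h := ((hmean.comp (tendsto_id.const_mul_atTop (show (0 : ℝ) < 4 by norm_num))).const_mul
      (8192 * ‖x‖))
    rw [mul_zero] at h
    refine squeeze_zero_norm' ?_ h
    filter_upwards [eventually_gt_atTop 0, eventually_ge_atTop ‖x‖] with r hr hrx
    exact abs_wmean_sub_le hv.continuous x hr hrx
  have e : ∀ z r, ∫ y, logProfile (r ^ 2 / ‖y‖ ^ 2) * f (z + y) =
      ∫ y, logProfile (r ^ 2 / ‖z - y‖ ^ 2) * f y := by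
    intro z r
    rw [← integral_add_left_eq_self (fun y => logProfile (r ^ 2 / ‖z - y‖ ^ 2) * f y) z]
    simp
  have hi : ∀ z r, 0 < r → Integrable fun y => logProfile (r ^ 2 / ‖z - y‖ ^ 2) * f y := by
    intro z r hr
    have := (integrable_logProfile_mul hf hfi z hr).comp_sub_right z
    refine this.congr (Eventually.of_forall fun y => ?_)
    simp [norm_sub_rev]
  -- Each `Q`-integral separately may diverge; the difference converges because `|Q(a) - Q(b)| ≤ 4
  -- |log a - log b|` gives an `r`-independent dominating function.
  have h2 : Tendsto (fun r : ℝ => ∫ y, (logProfile (r ^ 2 / ‖x - y‖ ^ 2) -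
      logProfile (r ^ 2 / ‖0 - y‖ ^ 2)) * f y) atTop
      (𝓝 (∫ y, (-8) * ((Real.log ‖x - y‖ - Real.log ‖0 - y‖) * f y))) := by
    refine tendsto_integral_filter_of_dominated_convergence
      (fun y => 8 * ‖(Real.log ‖x - y‖ - Real.log ‖0 - y‖) * f y‖) ?_ ?_
      ((integrable_log_sub_log hf hfi x 0).norm.const_mul 8) ?_
    · refine Eventually.of_forall fun r => Measurable.aestronglyMeasurable ?_
      exact ((measurable_logProfile.comp (by fun_prop)).sub
        (measurable_logProfile.comp (by fun_prop))).mul hf.measurable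
    · filter_upwards [eventually_gt_atTop 0] with r hr
      filter_upwards [Measure.ae_ne volume x, Measure.ae_ne volume (0 : R4)] with y hy hy0
      have ha : 0 < ‖x - y‖ := norm_sub_pos_iff.2 hy.symm
      have hb : 0 < ‖0 - y‖ := norm_sub_pos_iff.2 hy0.symm
      have h3 := abs_logProfile_sub_le (a := r ^ 2 / ‖x - y‖ ^ 2) (b := r ^ 2 / ‖0 - y‖ ^ 2)
        (by positivity) (by positivity)
      rw [Real.log_div (by positivity) (by positivity),
        Real.log_div (by positivity) (by positivity), Real.log_pow, Real.log_pow, Real.log_pow,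
        sub_sub_sub_cancel_left] at h3
      rw [norm_mul, norm_mul, Real.norm_eq_abs, Real.norm_eq_abs (_ - _), ← mul_assoc]
      gcongr
      refine h3.trans_eq ?_
      push_cast
      rw [← mul_sub, abs_mul, abs_sub_comm]
      norm_num
      ring
    · filter_upwards [Measure.ae_ne volume x, Measure.ae_ne volume (0 : R4)] with y hy hy0
      have ha : 0 < ‖x - y‖ := norm_sub_pos_iff.2 hy.symm
      have hb : 0 < ‖0 - y‖ := norm_sub_pos_iff.2 hy0.symm
      have h3 := (tendsto_logProfile_sub (a := (‖x - y‖ ^ 2)⁻¹) (b := (‖0 - y‖ ^ 2)⁻¹)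
        (by positivity) (by positivity)).comp (tendsto_pow_atTop (α := ℝ) two_ne_zero)
      have h4 := h3.mul_const (f y)
      rw [Real.log_inv, Real.log_inv, Real.log_pow, Real.log_pow] at h4
      push_cast at h4
      have e1 : 4 * (-(2 * Real.log ‖x - y‖) - -(2 * Real.log ‖0 - y‖)) * f y =
        (-8) * ((Real.log ‖x - y‖ - Real.log ‖0 - y‖) * f y) := by ring
      rw [e1] at h4
      simpa only [Function.comp, div_eq_mul_inv] using h4
  have h3 : Tendsto (fun _ : ℝ => (v x - v 0) * (omega3 / 12)) atTop
      (𝓝 (0 + 1 / 384 * ∫ y, (-8) * ((Real.log ‖x - y‖ - Real.log ‖0 - y‖) * f y))) := by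
    refine (h1.add (h2.const_mul (1 / 384))).congr' ?_
    filter_upwards [eventually_gt_atTop 0] with r hr
    have hx := wmean_add_integral_logProfile_eq_of_isLittleO hv hΔ hf hfi hvo x hr
    have h0 := wmean_add_integral_logProfile_eq_of_isLittleO hv hΔ hf hfi hvo 0 hr
    rw [e] at hx h0
    simp_rw [sub_mul]
    rw [integral_sub (hi x r hr) (hi 0 r hr)]
    linear_combination hx - h0
  have h4 := tendsto_nhds_unique tendsto_const_nhds h3
  rw [integral_const_mul] at h4
  field_simp
  linear_combination 12 * 4 * h4

/-! ### Lower bound for `u` and sublinear means of `|v|` -/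

/-- A positive superharmonic function on `ℝ⁴` decays at most like `|x|⁻²`. -/
lemma exists_div_sq_le {u g : R4 → ℝ} (hu : ContDiff ℝ 2 u) (hu0 : ∀ x, 0 < u x)
    (hΔ : ∀ x, -(Δ u) x = g x) (hg : Continuous g) (hgi : Integrable g) (hg0 : ∀ x, 0 < g x) :
    ∃ c, 0 < c ∧ ∀ x, c / (1 + ‖x‖) ^ 2 ≤ u x := by
  have hω := omega3_pos
  set m := ∫ y in Metric.ball (0 : R4) 1, g y with hm
  have hm0 : 0 < m := by
    rw [hm, integral_pos_iff_support_of_nonneg (fun y => (hg0 y).le) hgi.integrableOn]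
    have : Function.support g = Set.univ := by
      ext y; simp [(hg0 y).ne']
    rw [this, Measure.restrict_apply_univ]
    exact Metric.measure_ball_pos _ _ one_pos
  refine ⟨12 / omega3 * (1 / 24 * (27 / 64 * m)), by positivity, fun x => ?_⟩
  set R := 1 + ‖x‖ with hR
  have hR0 : 0 < R := by positivity
  -- At radius `2R` the unit ball about the origin lies where the weight is at least `(3/4)³ =
  -- 27/64`; dropping the nonnegative mean of `u`, only the mass of `g` there is kept.
  have h1 := wmean_add_integral_eq one_ne_zero hu hΔ hgi x (show 0 < 2 * R by positivity)
  rw [integral_bump_one] at h1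
  have h2 : 0 ≤ wmean 1 u x (2 * R) :=
    integral_nonneg fun y => mul_nonneg (hu0 _).le (bump_nonneg _ _)
  have hI := integrable_translate_div_norm_sq hg hgi x
  have h3 : 27 / 64 / R ^ 2 * m ≤
      ∫ y, bump (1 + 2) ((2 * R)⁻¹ • y) * (g (x + y) / ‖y‖ ^ 2) := by
    rw [hm, ← integral_indicator measurableSet_ball, ← integral_const_mul,
      ← integral_add_left_eq_self _ x]
    refine integral_mono_ae (((hgi.indicator measurableSet_ball).comp_add_left x).const_mul _)
      (hI.norm.mono' ((continuous_bump_inv_smul _ _).aestronglyMeasurable.mul hI.1)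
      (Eventually.of_forall fun y => ?_)) ?_
    · rw [norm_mul, Real.norm_of_nonneg (bump_nonneg _ _)]
      exact mul_le_of_le_one_left (norm_nonneg _) (bump_le_one _ _)
    · filter_upwards [Measure.ae_ne volume (0 : R4)] with y hy0
      have hn : 0 < ‖y‖ := norm_pos_iff.2 hy0
      by_cases hy : x + y ∈ Metric.ball (0 : R4) 1
      · rw [Set.indicator_of_mem hy]
        have hyR : ‖y‖ ≤ R := by
          have h4 : ‖x + y‖ < 1 := by simpa using hy
          have h5 : ‖y‖ ≤ ‖x + y‖ + ‖x‖ := by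
            simpa using norm_sub_le (x + y) x
          linarith
        have hb : 27 / 64 ≤ bump (1 + 2) ((2 * R)⁻¹ • y) := by
          unfold bump
          rw [norm_smul, norm_inv, Real.norm_of_nonneg (by positivity)]
          have h6 : (2 * R)⁻¹ * ‖y‖ ≤ 1 / 2 := by
            rw [inv_mul_le_iff₀ (by positivity)]; linarith
          have h7 : 0 ≤ (2 * R)⁻¹ * ‖y‖ := by positivity
          have h8 : 3 / 4 ≤ max 0 (1 - ((2 * R)⁻¹ * ‖y‖) ^ 2) :=
            le_max_of_le_right (by nlinarith)
          calc (27 / 64 : ℝ) = (3 / 4) ^ 3 := by norm_num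
            _ ≤ _ := by gcongr
        have hgx := (hg0 (x + y)).le
        calc 27 / 64 / R ^ 2 * g (x + y) = 27 / 64 * (g (x + y) / R ^ 2) := by ring
          _ ≤ _ := by gcongr
      · rw [Set.indicator_of_notMem hy, mul_zero]
        exact mul_nonneg (bump_nonneg _ _) (div_nonneg (hg0 _).le (by positivity))
  norm_num at h1 h3
  have h4 : u x = 12 / omega3 * (u x * (omega3 / 12)) := by field_simp
  rw [h4, ← h1]
  have h5 : 1 / 24 * (27 / 64 / R ^ 2 * m) ≤ wmean 1 u x (2 * R) + 1 / 24 *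
      ∫ y, bump 3 ((R⁻¹ * (1 / 2)) • y) * (g (x + y) / ‖y‖ ^ 2) := by linarith
  calc _ = 12 / omega3 * (1 / 24 * (27 / 64 / R ^ 2 * m)) := by ring
    _ ≤ _ := by gcongr

lemma nonlin_eq_exp {p q : ℝ} {u v : R4 → ℝ} (hu : ∀ x, 0 < u x) (x : R4) :
    nonlin p q u v x = Real.exp (p * Real.log (u x) + q * v x) := by
  unfold nonlin
  rw [Real.exp_add, Real.rpow_def_of_pos (hu x), mul_comm p]

lemma nonlin_pos {p q : ℝ} {u v : R4 → ℝ} (hu : ∀ x, 0 < u x) (x : R4) : 0 < nonlin p q u v x := by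
  rw [nonlin_eq_exp hu]
  exact Real.exp_pos _

lemma continuous_nonlin {p q : ℝ} {u v : R4 → ℝ} (hu : ∀ x, 0 < u x) (huc : Continuous u)
    (hvc : Continuous v) : Continuous (nonlin p q u v) :=
  (huc.rpow_const fun x => Or.inl (hu x).ne').mul (by fun_prop)

lemma tendsto_log_one_add_div : Tendsto (fun r : ℝ => Real.log (1 + r) / r) atTop (𝓝 0) := by
  have h1 : Tendsto (fun r : ℝ => Real.log (1 + r) / (1 + r)) atTop (𝓝 0) :=
    Real.isLittleO_log_id_atTop.tendsto_div_nhds_zero.comp (tendsto_atTop_add_const_left _ 1 tendsto_id)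
  have h2 : Tendsto (fun r : ℝ => 2 * (Real.log (1 + r) / (1 + r))) atTop (𝓝 0) := by
    simpa using h1.const_mul 2
  refine squeeze_zero' ?_ ?_ h2
  · filter_upwards [eventually_ge_atTop 0] with r hr
    exact div_nonneg (Real.log_nonneg (by linarith)) hr
  · filter_upwards [eventually_ge_atTop 1] with r hr
    have := Real.log_nonneg (show 1 ≤ 1 + r by linarith)
    rw [div_le_iff₀ (by linarith)]
    have : Real.log (1 + r) / (1 + r) * (2 * r) ≥ Real.log (1 + r) := by
      rw [ge_iff_le, div_mul_eq_mul_div, le_div_iff₀ (by linarith)]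
      nlinarith
    linarith

/-- The averages of `|v|` grow sublinearly. -/
lemma tendsto_wmean_abs_div {p₁ q₁ : ℝ} (hp₁ : 0 ≤ p₁) (hq₁ : 0 < q₁) {u v f : R4 → ℝ}
    (hu : ContDiff ℝ 2 u) (hu0 : ∀ x, 0 < u x) (hΔu : ∀ x, -(Δ u) x = nonlin p₁ q₁ u v x)
    (hgi : Integrable (nonlin p₁ q₁ u v)) (hv : ContDiff ℝ 4 v)
    (hΔ : ∀ x, -(Δ (-(Δ v))) x = f x) (hf : Continuous f) (hfi : Integrable f)
    (hvo : v =o[cocompact R4] fun x => ‖x‖ ^ 2) :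
    Tendsto (fun r => wmean 1 (fun y => |v y|) 0 r / r) atTop (𝓝 0) := by
  have hω := omega3_pos
  set g := nonlin p₁ q₁ u v with hg_def
  have hg : Continuous g := continuous_nonlin hu0 hu.continuous hv.continuous
  have hg0 : ∀ x, 0 < g x := nonlin_pos hu0
  obtain ⟨c, hc, hcu⟩ := exists_div_sq_le hu hu0 hΔu hg hgi hg0
  -- A nonnegative majorant of `v`: solve `log g = p₁ log u + q₁ v` for `v`, with `log g ≤ g` and
  -- the lower bound on `u`.
  set ψ : R4 → ℝ := fun x => (g x + p₁ * (2 * Real.log (1 + ‖x‖) + |Real.log c|)) / q₁ with hψ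
  have hlog : ∀ x : R4, 0 ≤ Real.log (1 + ‖x‖) := fun x =>
    Real.log_nonneg (by linarith [norm_nonneg x])
  have hψ0 : ∀ x, 0 ≤ ψ x := fun x => by
    have := hlog x
    have := (hg0 x).le
    positivity
  have hvψ : ∀ x, v x ≤ ψ x := fun x => by
    rw [hψ]
    simp only
    rw [le_div_iff₀ hq₁]
    have h1 : p₁ * Real.log (u x) + q₁ * v x ≤ g x := by
      rw [hg_def, nonlin_eq_exp hu0]
      linarith [Real.add_one_le_exp (p₁ * Real.log (u x) + q₁ * v x)]
    have h2 : Real.log c - 2 * Real.log (1 + ‖x‖) ≤ Real.log (u x) := by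
      have h3 := Real.log_le_log (by positivity) (hcu x)
      rw [Real.log_div hc.ne' (by positivity), Real.log_pow] at h3
      exact_mod_cast h3
    have h4 : -|Real.log c| ≤ Real.log c := neg_abs_le _
    have h5 : p₁ * (-|Real.log c| - 2 * Real.log (1 + ‖x‖)) ≤ p₁ * Real.log (u x) :=
      mul_le_mul_of_nonneg_left (by linarith) hp₁
    linarith
  have hψc : Continuous ψ := by
    have : Continuous fun x : R4 => Real.log (1 + ‖x‖) :=
      (by fun_prop : Continuous fun x : R4 => 1 + ‖x‖).log fun x => by positivity
    fun_prop
  -- This trades the mean of `|v|` for the mean of `ψ` and that of `v`, the latter being known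
  -- exactly from Green's identity.
  have habs : ∀ x, |v x| ≤ 2 * ψ x - v x := fun x => by
    rw [abs_le]
    constructor <;> linarith [hψ0 x, hvψ x]
  have hbound : ∀ r : ℝ, 1 ≤ r → wmean 1 (fun y => |v y|) 0 r / r ≤
      (2 / q₁) * ((∫ y, g y) * r⁻¹ + (p₁ * (2 * (Real.log (1 + r) / r) + |Real.log c| * r⁻¹)) *
        (omega3 / 12)) + (1 / 384 * ((∫ y, logProfile (r ^ 2 / ‖y‖ ^ 2) * f (0 + y)) / r) -
        v 0 * (omega3 / 12) * r⁻¹) := by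
    intro r hr
    have hr0 : 0 < r := by linarith
    have h1 : wmean 1 (fun y => |v y|) 0 r ≤ 2 * wmean 1 ψ 0 r - wmean 1 v 0 r := by
      have h2 : 2 * wmean 1 ψ 0 r - wmean 1 v 0 r = wmean 1 (fun y => 2 * ψ y - v y) 0 r := by
        unfold wmean
        rw [← integral_const_mul, ← integral_sub]
        · exact integral_congr_ae (Eventually.of_forall fun y => by simp only; ring)
        · exact (integrable_mul_bump one_ne_zero (hψc.comp (by fun_prop))).const_mul 2
        · exact integrable_mul_bump one_ne_zero (hv.continuous.comp (by fun_prop))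
      rw [h2]
      exact wmean_mono one_ne_zero hv.continuous.abs ((hψc.const_mul 2).sub hv.continuous)
        fun y _ => habs _
    have h3 : wmean 1 ψ 0 r ≤ 1 / q₁ * ((∫ y, g y) +
        (p₁ * (2 * Real.log (1 + r) + |Real.log c|)) * (omega3 / 12)) := by
      have h4 : wmean 1 g 0 r ≤ ∫ y, g y := by
        have h5 := integral_mul_bump_inv_smul 1 g 0 hr0
        have h6 : ∫ y, g (0 + y) * bump 1 (r⁻¹ • y) ≤ ∫ y, g y := by
          refine integral_mono_of_nonneg (Eventually.of_forall fun y =>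
            mul_nonneg (hg0 _).le (bump_nonneg _ _)) hgi (Eventually.of_forall fun y => ?_)
          simp only [zero_add]
          exact mul_le_of_le_one_right (hg0 _).le (bump_le_one _ _)
        have h7 : 0 ≤ wmean 1 g 0 r :=
          integral_nonneg fun y => mul_nonneg (hg0 _).le (bump_nonneg _ _)
        have h8 : 1 ≤ r ^ 4 := one_le_pow₀ hr
        nlinarith
      calc wmean 1 ψ 0 r ≤ wmean 1 (fun y => 1 / q₁ * (g y +
            p₁ * (2 * Real.log (1 + r) + |Real.log c|))) 0 r := by
            refine wmean_mono one_ne_zero hψc (by fun_prop) fun y hy => ?_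
            simp only [hψ]
            rw [div_eq_inv_mul, ← one_div]
            have : ‖(0 : R4) + r • y‖ ≤ r := by
              rw [zero_add, norm_smul, Real.norm_of_nonneg hr0.le]
              nlinarith
            gcongr
        _ = 1 / q₁ * (wmean 1 g 0 r +
            p₁ * (2 * Real.log (1 + r) + |Real.log c|) * (omega3 / 12)) := by
            unfold wmean
            simp_rw [mul_assoc (1 / q₁), add_mul]
            rw [integral_const_mul, integral_add, integral_const_mul, integral_bump_one]
            · exact integrable_mul_bump one_ne_zero (hg.comp (by fun_prop))
            · exact (integrable_bump one_ne_zero).const_mul _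
        _ ≤ _ := by gcongr
    have h5 := wmean_add_integral_logProfile_eq_of_isLittleO hv hΔ hf hfi hvo 0 hr0
    rw [div_le_iff₀ hr0]
    have h6 : ((2 / q₁) * ((∫ y, g y) * r⁻¹ + (p₁ * (2 * (Real.log (1 + r) / r) +
        |Real.log c| * r⁻¹)) * (omega3 / 12)) +
        (1 / 384 * ((∫ y, logProfile (r ^ 2 / ‖y‖ ^ 2) * f (0 + y)) / r) -
        v 0 * (omega3 / 12) * r⁻¹)) * r = 2 * (1 / q₁ * ((∫ y, g y) +
        (p₁ * (2 * Real.log (1 + r) + |Real.log c|)) * (omega3 / 12))) +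
        (1 / 384 * (∫ y, logProfile (r ^ 2 / ‖y‖ ^ 2) * f (0 + y)) - v 0 * (omega3 / 12)) := by
      field_simp
    rw [h6]
    linarith
  have hlim : Tendsto (fun r : ℝ => (2 / q₁) * ((∫ y, g y) * r⁻¹ +
      (p₁ * (2 * (Real.log (1 + r) / r) + |Real.log c| * r⁻¹)) *
        (omega3 / 12)) + (1 / 384 * ((∫ y, logProfile (r ^ 2 / ‖y‖ ^ 2) * f (0 + y)) / r) -
        v 0 * (omega3 / 12) * r⁻¹)) atTop (𝓝 0) := by
    have hi : Tendsto (fun r : ℝ => r⁻¹) atTop (𝓝 0) := tendsto_inv_atTop_zero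
    have h := ((((hi.const_mul (∫ y, g y)).add
      ((((tendsto_log_one_add_div.const_mul 2).add (hi.const_mul |Real.log c|)).const_mul
        p₁).mul_const (omega3 / 12))).const_mul (2 / q₁)).add
      (((tendsto_integral_logProfile_div hf hfi 0).const_mul (1 / 384)).sub
        (hi.const_mul (v 0 * (omega3 / 12)))))
    simpa using h
  refine squeeze_zero' ?_ ?_ hlim
  · filter_upwards [eventually_ge_atTop 0] with r hr
    exact div_nonneg (integral_nonneg fun y => mul_nonneg (abs_nonneg _) (bump_nonneg _ _)) hr
  · filter_upwards [eventually_ge_atTop 1] with r hr using hbound r hr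

/-! ### Differentiation of the logarithmic potential -/

lemma half_log_sq_add_sub_log {d ε : ℝ} (hd : 0 < d) :
    |1 / 2 * Real.log (d ^ 2 + ε ^ 2) - Real.log d| ≤ ε ^ 2 * (1 / d ^ 2) := by
  have h1 : 1 / 2 * Real.log (d ^ 2 + ε ^ 2) - Real.log d =
      1 / 2 * Real.log (1 + ε ^ 2 * (1 / d ^ 2)) := by
    have : Real.log d = 1 / 2 * Real.log (d ^ 2) := by rw [Real.log_pow]; push_cast; ring
    rw [this, ← mul_sub, ← Real.log_div (by positivity) (by positivity)]
    congr 2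
    field_simp
  have h2 : 0 ≤ ε ^ 2 * (1 / d ^ 2) := by positivity
  have h3 := Real.log_nonneg (show 1 ≤ 1 + ε ^ 2 * (1 / d ^ 2) by linarith)
  have h4 := Real.log_le_sub_one_of_pos (show 0 < 1 + ε ^ 2 * (1 / d ^ 2) by linarith)
  rw [h1, abs_of_nonneg (by positivity)]
  linarith

lemma hasFDerivAt_half_log (y x : R4) {ε : ℝ} (hε : 0 < ε) :
    HasFDerivAt (fun x : R4 => 1 / 2 * Real.log (‖x - y‖ ^ 2 + ε ^ 2))
      ((‖x - y‖ ^ 2 + ε ^ 2)⁻¹ • innerSL ℝ (x - y)) x := by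
  have h1 : HasFDerivAt (fun x : R4 => ‖x - y‖ ^ 2 + ε ^ 2) (2 • innerSL ℝ (x - y)) x := by
    have h := (hasStrictFDerivAt_norm_sq (x - y)).hasFDerivAt.comp x
      ((hasFDerivAt_id x).sub_const y)
    exact (h.add_const (ε ^ 2)).congr_fderiv (by ext z; simp)
  refine ((h1.log (by positivity)).const_mul (1 / 2)).congr_fderiv ?_
  ext z
  simp
  ring

lemma norm_sub_smul_innerSL_le (a : ℝ) {z : R4} {C : ℝ} (h : |a| * ‖z‖ ≤ C) :
    ‖a • innerSL ℝ z‖ ≤ C := by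
  rwa [norm_smul, innerSL_apply_norm, Real.norm_eq_abs]

lemma integrable_gradient_kernel {f : R4 → ℝ} (hf : Continuous f) (hfi : Integrable f) (x : R4) :
    Integrable fun y => (f y / ‖x - y‖ ^ 2) • (x - y) := by
  refine (hfi.norm.add (integrable_div_norm_sq hf hfi x).norm).mono'
    (Measurable.aestronglyMeasurable
      ((hf.measurable.div (by fun_prop)).smul (by fun_prop))) ?_
  filter_upwards [Measure.ae_ne volume x] with y hy
  have hd : 0 < ‖x - y‖ := norm_sub_pos_iff.2 hy.symm
  rw [norm_smul, norm_div, norm_pow, norm_norm]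
  simp only [Pi.add_apply]
  rw [norm_div, norm_pow, norm_norm]
  calc _ = ‖f y‖ * (1 / ‖x - y‖) := by field_simp
    _ ≤ ‖f y‖ * (1 + 1 / ‖x - y‖ ^ 2) := by gcongr; exact one_div_le_one_add hd
    _ = _ := by ring

/-- The gradient of a logarithmic potential. -/
lemma hasFDerivAt_log_potential {f : R4 → ℝ} (hf : Continuous f) (hfi : Integrable f)
    (hf0 : ∀ y, 0 ≤ f y) (hZ : Continuous fun x : R4 => ∫ y, f y / ‖x - y‖ ^ 2) (x : R4) :
    HasFDerivAt (fun x : R4 => ∫ y, (Real.log ‖x - y‖ - Real.log (‖y‖ + 1)) * f y)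
      (∫ y, (f y / ‖x - y‖ ^ 2) • innerSL ℝ (x - y)) x := by
  have hI := fun x : R4 => integrable_div_norm_sq hf hfi x
  -- Replacing `|x-y|` by `√(|x-y|² + ε²)` makes the kernel smooth, with gradient bounded by `1/ε`,
  -- so differentiation under the integral is legitimate.
  set F : ℝ → R4 → R4 → ℝ := fun ε x y =>
    (1 / 2 * Real.log (‖x - y‖ ^ 2 + ε ^ 2) - Real.log (‖y‖ + 1)) * f y with hF
  have hdiff : ∀ ε : ℝ, ∀ x : R4, ∀ y, y ≠ x →
      |F ε x y - (Real.log ‖x - y‖ - Real.log (‖y‖ + 1)) * f y| ≤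
        ε ^ 2 * (f y / ‖x - y‖ ^ 2) := by
    intro ε x y hy
    have hd : 0 < ‖x - y‖ := norm_sub_pos_iff.2 hy.symm
    have h1 : F ε x y - (Real.log ‖x - y‖ - Real.log (‖y‖ + 1)) * f y =
        (1 / 2 * Real.log (‖x - y‖ ^ 2 + ε ^ 2) - Real.log ‖x - y‖) * f y := by
      simp only [hF]; ring
    rw [h1, abs_mul, abs_of_nonneg (hf0 y)]
    calc _ ≤ ε ^ 2 * (1 / ‖x - y‖ ^ 2) * f y :=
          mul_le_mul_of_nonneg_right (half_log_sq_add_sub_log hd) (hf0 y)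
      _ = _ := by ring
  have hFm : ∀ ε x, AEStronglyMeasurable (F ε x) volume := fun ε x =>
    Measurable.aestronglyMeasurable (by fun_prop)
  have hFd : ∀ ε x, Integrable fun y =>
      F ε x y - (Real.log ‖x - y‖ - Real.log (‖y‖ + 1)) * f y := by
    intro ε x
    refine ((hI x).const_mul (ε ^ 2)).mono' ((hFm ε x).sub (integrable_log_kernel hf hfi x).1) ?_
    filter_upwards [Measure.ae_ne volume x] with y hy using hdiff ε x y hy
  have hFi : ∀ ε x, Integrable (F ε x) := fun ε x =>
    ((hFd ε x).add (integrable_log_kernel hf hfi x)).congr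
      (Eventually.of_forall fun y => by simp)
  have hder : ∀ ε : ℝ, 0 < ε → ∀ x, Integrable (fun y =>
      (f y * (‖x - y‖ ^ 2 + ε ^ 2)⁻¹) • innerSL ℝ (x - y)) ∧
      HasFDerivAt (fun x => ∫ y, F ε x y)
      (∫ y, (f y * (‖x - y‖ ^ 2 + ε ^ 2)⁻¹) • innerSL ℝ (x - y)) x := by
    intro ε hε x
    have hm : AEStronglyMeasurable (fun y =>
        (f y * (‖x - y‖ ^ 2 + ε ^ 2)⁻¹) • innerSL ℝ (x - y)) volume := by
      refine Continuous.aestronglyMeasurable ?_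
      refine (hf.mul (Continuous.inv₀ (by fun_prop) fun y => by positivity)).smul ?_
      exact (innerSL ℝ).continuous.comp (by fun_prop)
    have hb : ∀ x y : R4, ‖(f y * (‖x - y‖ ^ 2 + ε ^ 2)⁻¹) • innerSL ℝ (x - y)‖ ≤ f y * ε⁻¹ := by
      intro x y
      refine norm_sub_smul_innerSL_le _ ?_
      have := hf0 y
      rw [abs_of_nonneg (by positivity), mul_assoc]
      refine mul_le_mul_of_nonneg_left ?_ this
      rw [inv_mul_le_iff₀ (by positivity), ← div_eq_mul_inv, le_div_iff₀ hε]
      nlinarith [sq_nonneg (‖x - y‖ - ε), sq_nonneg ε, sq_nonneg ‖x - y‖]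
    refine ⟨(hfi.mul_const ε⁻¹).mono' hm (Eventually.of_forall (hb x)), ?_⟩
    refine hasFDerivAt_integral_of_dominated_of_fderiv_le (s := Set.univ)
      (bound := fun y => f y * ε⁻¹)
      (F' := fun x y => (f y * (‖x - y‖ ^ 2 + ε ^ 2)⁻¹) • innerSL ℝ (x - y))
      Filter.univ_mem (Eventually.of_forall (hFm ε)) (hFi ε x) hm
      (Eventually.of_forall fun y x _ => hb x y) (hfi.mul_const _)
      (Eventually.of_forall fun y x _ => ?_)
    refine (((hasFDerivAt_half_log y x hε).sub_const _).mul_const (f y)).congr_fderiv ?_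
    ext z
    simp
    ring
  have hlimi : ∀ x : R4, Integrable fun y => (f y / ‖x - y‖ ^ 2) • innerSL ℝ (x - y) := by
    intro x
    refine (integrable_gradient_kernel hf hfi x).norm.mono' ?_ (Eventually.of_forall fun y => ?_)
    · exact AEStronglyMeasurable.smul (hI x).1
        (((innerSL ℝ).continuous.comp (by fun_prop)).aestronglyMeasurable)
    · rw [norm_smul, norm_smul, innerSL_apply_norm]
  -- The regularised gradients differ from the limit by at most `ε ∫ f/|z-y|²`; continuity of this
  -- integral bounds it near `x` and makes the convergence uniform there.
  obtain ⟨M, hM⟩ := (isCompact_closedBall x 1).exists_bound_of_continuousOn hZ.continuousOn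
  have hε : Tendsto (fun n : ℕ => 1 / ((n : ℝ) + 1)) atTop (𝓝 0) :=
    tendsto_one_div_add_atTop_nhds_zero_nat
  refine hasFDerivAt_of_tendstoUniformlyOn (l := atTop) (s := Metric.ball x 1)
    (f := fun n : ℕ => fun x => ∫ y, F (1 / ((n : ℝ) + 1)) x y)
    (f' := fun n : ℕ => fun x => ∫ y,
      (f y * (‖x - y‖ ^ 2 + (1 / ((n : ℝ) + 1)) ^ 2)⁻¹) • innerSL ℝ (x - y))
    (g' := fun x => ∫ y, (f y / ‖x - y‖ ^ 2) • innerSL ℝ (x - y))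
    Metric.isOpen_ball ?_ (fun n x _ => (hder _ (by positivity) x).2) (fun z _ => ?_)
    (Metric.mem_ball_self one_pos)
  · rw [Metric.tendstoUniformlyOn_iff]
    intro δ hδ
    have hε' := hε.mul_const M
    rw [zero_mul] at hε'
    filter_upwards [hε'.eventually_lt_const hδ] with n hn z hz
    have hεn : 0 < 1 / ((n : ℝ) + 1) := by positivity
    set ε := 1 / ((n : ℝ) + 1)
    refine lt_of_le_of_lt ?_ hn
    rw [dist_eq_norm, ← integral_sub (hlimi z) (hder ε hεn z).1]
    have hle : ∀ᵐ y : R4, ‖(f y / ‖z - y‖ ^ 2) • innerSL ℝ (z - y) -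
        (f y * (‖z - y‖ ^ 2 + ε ^ 2)⁻¹) • innerSL ℝ (z - y)‖ ≤ ε * (f y / ‖z - y‖ ^ 2) := by
      filter_upwards [Measure.ae_ne volume z] with y hy
      have hd : 0 < ‖z - y‖ := norm_sub_pos_iff.2 hy.symm
      rw [← sub_smul]
      refine norm_sub_smul_innerSL_le _ ?_
      have h1 : f y / ‖z - y‖ ^ 2 - f y * (‖z - y‖ ^ 2 + ε ^ 2)⁻¹ =
          f y * (ε ^ 2 / (‖z - y‖ ^ 2 * (‖z - y‖ ^ 2 + ε ^ 2))) := by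
        field_simp
        ring
      have := hf0 y
      rw [h1, abs_of_nonneg (by positivity)]
      have h2 : ε ^ 2 / (‖z - y‖ ^ 2 * (‖z - y‖ ^ 2 + ε ^ 2)) * ‖z - y‖ ≤ ε * (1 / ‖z - y‖ ^ 2) := by
        rw [div_mul_eq_mul_div, mul_one_div, div_le_div_iff₀ (by positivity) (by positivity)]
        have h3 : ε * ‖z - y‖ ≤ ‖z - y‖ ^ 2 + ε ^ 2 := by
          nlinarith [sq_nonneg (‖z - y‖ - ε), sq_nonneg ε, sq_nonneg ‖z - y‖]
        have h4 : 0 ≤ ε * ‖z - y‖ ^ 2 := by positivity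
        nlinarith [mul_le_mul_of_nonneg_left h3 h4]
      calc _ = f y * (ε ^ 2 / (‖z - y‖ ^ 2 * (‖z - y‖ ^ 2 + ε ^ 2)) * ‖z - y‖) := by ring
        _ ≤ f y * (ε * (1 / ‖z - y‖ ^ 2)) := by gcongr
        _ = _ := by ring
    refine (norm_integral_le_of_norm_le ((hI z).const_mul ε) hle).trans ?_
    rw [integral_const_mul]
    exact mul_le_mul_of_nonneg_left
      ((le_abs_self _).trans (hM z (Metric.ball_subset_closedBall hz))) hεn.le
  · have h1 := (hε.pow 2).mul_const (∫ y, f y / ‖z - y‖ ^ 2)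
    norm_num only [zero_mul, ne_eq, OfNat.ofNat_ne_zero, not_false_eq_true, zero_pow] at h1
    rw [tendsto_iff_norm_sub_tendsto_zero]
    refine squeeze_zero (fun _ => norm_nonneg _) (fun n => ?_) h1
    rw [← integral_sub (hFi _ z) (integrable_log_kernel hf hfi z), ← integral_const_mul]
    refine norm_integral_le_of_norm_le ((hI z).const_mul _) ?_
    filter_upwards [Measure.ae_ne volume z] with y hy
    simpa using hdiff (1 / ((n : ℝ) + 1)) z y hy

lemma hasGradientAt_of_log_representation {v f : R4 → ℝ} (hf : Continuous f) (hfi : Integrable f)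
    (hf0 : ∀ y, 0 ≤ f y) (hZ : Continuous fun x : R4 => ∫ y, f y / ‖x - y‖ ^ 2) {c c₀ : ℝ}
    (hv : ∀ x, v x = c * (∫ y, (Real.log ‖x - y‖ - Real.log (‖y‖ + 1)) * f y) + c₀) (x : R4) :
    HasGradientAt v (c • ∫ y, (f y / ‖x - y‖ ^ 2) • (x - y)) x := by
  rw [hasGradientAt_iff_hasFDerivAt]
  have h := ((hasFDerivAt_log_potential hf hfi hf0 hZ x).const_mul c).add_const c₀
  rw [← funext hv] at h
  refine h.congr_fderiv ?_
  have hlimi : Integrable fun y => (f y / ‖x - y‖ ^ 2) • innerSL ℝ (x - y) := by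
    refine (integrable_gradient_kernel hf hfi x).norm.mono' ?_ (Eventually.of_forall fun y => ?_)
    · exact AEStronglyMeasurable.smul (integrable_div_norm_sq hf hfi x).1
        (((innerSL ℝ).continuous.comp (by fun_prop)).aestronglyMeasurable)
    · rw [norm_smul, norm_smul, innerSL_apply_norm]
  ext z
  simp only [InnerProductSpace.toDual_apply_apply, inner_smul_left]
  rw [real_inner_comm, ← integral_inner (integrable_gradient_kernel hf hfi x)]
  simp only [smul_apply]
  rw [ContinuousLinearMap.integral_apply hlimi]
  simp only [smul_apply, innerSL_apply_apply, inner_smul_right, smul_eq_mul]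
  simp [real_inner_comm]

/-! ### Behaviour at infinity of the two parts of the logarithmic potential -/

lemma eventually_cocompact_iff_norm {P : R4 → Prop} :
    (∀ᶠ x in cocompact R4, P x) ↔ ∃ R : ℝ, ∀ x, R ≤ ‖x‖ → P x := by
  rw [← Metric.cobounded_eq_cocompact, ← comap_norm_atTop, eventually_comap]
  simp only [eventually_atTop]
  exact ⟨fun ⟨R, h⟩ => ⟨R, fun x hx => h _ hx x rfl⟩,
    fun ⟨R, h⟩ => ⟨R, fun b hb a ha => h a (ha ▸ hb)⟩⟩

lemma eventually_cocompact_le_norm (R : ℝ) : ∀ᶠ x in cocompact R4, R ≤ ‖x‖ :=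
  eventually_cocompact_iff_norm.2 ⟨R, fun _ h => h⟩

lemma eventually_cocompact_ball {P : R4 → Prop} (h : ∀ᶠ x in cocompact R4, P x) (R : ℝ) :
    ∀ᶠ x in cocompact R4, ∀ y ∈ Metric.ball x R, P y := by
  obtain ⟨R₀, h⟩ := eventually_cocompact_iff_norm.1 h
  filter_upwards [eventually_cocompact_le_norm (R₀ + R)] with x hx y hy
  refine h y ?_
  rw [Metric.mem_ball, dist_eq_norm] at hy
  have := norm_le_norm_add_norm_sub y x
  linarith

/-- Dominated convergence along `cocompact R4` requires a countably generated filter. -/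
instance isCountablyGenerated_cocompact_R4 : (cocompact R4).IsCountablyGenerated := by
  rw [← Metric.cobounded_eq_cocompact, ← comap_norm_atTop]
  infer_instance

lemma tendsto_log_norm_cocompact :
    Tendsto (fun x : R4 => Real.log ‖x‖) (cocompact R4) atTop :=
  Real.tendsto_log_atTop.comp (tendsto_norm_cocompact_atTop)

lemma tendsto_setIntegral_ball_cocompact {f : R4 → ℝ} (hfi : Integrable f) (R : ℝ) :
    Tendsto (fun x => ∫ y in Metric.ball x R, f y) (cocompact R4) (𝓝 0) := by
  simp_rw [← integral_indicator (Metric.isOpen_ball.measurableSet : MeasurableSet (Metric.ball _ R))]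
  rw [← integral_zero R4 ℝ]
  refine tendsto_integral_filter_of_dominated_convergence (fun y => ‖f y‖)
    (Eventually.of_forall fun x => (hfi.indicator measurableSet_ball).1)
    (Eventually.of_forall fun x => Eventually.of_forall fun y => norm_indicator_le_norm_self _ _)
    hfi.norm (Eventually.of_forall fun y => ?_)
  refine tendsto_const_nhds.congr' ?_
  filter_upwards [eventually_cocompact_le_norm (‖y‖ + R)] with x hx
  rw [Set.indicator_of_notMem]
  rw [Metric.mem_ball, dist_comm, dist_eq_norm, not_lt]
  have := norm_le_norm_add_norm_sub y x
  rw [norm_sub_rev] at this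
  linarith

/-- The negative part of the logarithm. -/
noncomputable def negLog (d : ℝ) : ℝ := max 0 (-Real.log d)

lemma negLog_nonneg (d : ℝ) : 0 ≤ negLog d := le_max_left _ _

lemma negLog_of_one_le {d : ℝ} (h : 1 ≤ d) : negLog d = 0 :=
  max_eq_left (by linarith [Real.log_nonneg h])

lemma negLog_of_le_one {d : ℝ} (h0 : 0 ≤ d) (h : d ≤ 1) : negLog d = -Real.log d :=
  max_eq_right (by linarith [Real.log_nonpos h0 h])

lemma measurable_negLog : Measurable negLog := by unfold negLog; fun_prop

lemma log_eq_log_max_sub_negLog {d : ℝ} (hd : 0 ≤ d) :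
    Real.log d = Real.log (max d 1) - negLog d := by
  rcases le_total d 1 with h | h
  · rw [max_eq_right h, negLog_of_le_one hd h]; simp
  · rw [max_eq_left h, negLog_of_one_le h]; simp

/-- The exponential of the singular part is no worse than `1/d`, locally integrable in dimension
four; the Brezis–Merle estimate rests on this. -/
lemma exp_negLog_le {d : ℝ} (hd : 0 < d) : Real.exp (negLog d) ≤ 1 + d⁻¹ := by
  have : 0 < d⁻¹ := by positivity
  rcases le_total d 1 with h | h
  · rw [negLog_of_le_one hd.le h, Real.exp_neg, Real.exp_log hd]; linarith
  · rw [negLog_of_one_le h, Real.exp_zero]; linarith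

lemma negLog_le {d : ℝ} (hd : 0 < d) : negLog d ≤ 1 + 1 / d ^ 2 := by
  have h1 := Real.add_one_le_exp (negLog d)
  have h2 := exp_negLog_le hd
  have h3 := one_div_le_one_add hd
  rw [one_div] at h3
  linarith

lemma integrable_negLog_mul {f : R4 → ℝ} (hf : Continuous f) (hfi : Integrable f) (x : R4) :
    Integrable fun y => negLog ‖x - y‖ * f y := by
  refine (hfi.norm.add (integrable_div_norm_sq hf hfi x).norm).mono'
    (Measurable.aestronglyMeasurable
      ((measurable_negLog.comp (by fun_prop)).mul hf.measurable)) ?_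
  filter_upwards [Measure.ae_ne volume x] with y hy
  have hd : 0 < ‖x - y‖ := norm_sub_pos_iff.2 hy.symm
  rw [norm_mul, Real.norm_of_nonneg (negLog_nonneg _)]
  calc _ ≤ (1 + 1 / ‖x - y‖ ^ 2) * ‖f y‖ := by gcongr; exact negLog_le hd
    _ = _ := by simp; ring

lemma integrable_indicator_inv_norm :
    Integrable ((Metric.ball (0 : R4) 1).indicator fun z => ‖z‖⁻¹) := by
  rw [integrable_indicator_iff measurableSet_ball]
  refine (integrableOn_rpow_norm_ball (a := -1) (by norm_num)).congr_fun
    (fun z _ => by simp [Real.rpow_neg_one]) measurableSet_ball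

lemma max_norm_sub_one_le (x y : R4) : max ‖x - y‖ 1 ≤ (‖x‖ + 1) * (‖y‖ + 1) := by
  have hx := norm_nonneg x
  have hy := norm_nonneg y
  refine max_le ((norm_sub_le _ _).trans ?_) ?_ <;> nlinarith [mul_nonneg hx hy]

lemma norm_add_one_le_mul_max (x y : R4) : ‖y‖ + 1 ≤ (‖x‖ + 2) * max ‖x - y‖ 1 := by
  have h1 : ‖y‖ ≤ ‖x‖ + ‖x - y‖ := norm_le_norm_add_norm_sub _ _
  have h2 := le_max_left ‖x - y‖ 1
  have h3 := le_max_right ‖x - y‖ 1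
  have hx := norm_nonneg x
  nlinarith

lemma log_norm_add_one_sub_le (x y : R4) :
    Real.log (‖y‖ + 1) - Real.log (max ‖x - y‖ 1) ≤ Real.log (‖x‖ + 2) := by
  have h0 : 0 < max ‖x - y‖ 1 := lt_of_lt_of_le one_pos (le_max_right _ _)
  rw [sub_le_iff_le_add, ← Real.log_mul (by positivity) h0.ne']
  exact Real.log_le_log (by positivity) (norm_add_one_le_mul_max x y)

/-- The nonsingular part of the logarithmic potential is asymptotic to `(∫ f) ln |x|`. -/
lemma tendsto_log_max_potential_div {f : R4 → ℝ} (hf : Continuous f) (hfi : Integrable f) :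
    Tendsto (fun x : R4 => (∫ y, (Real.log (max ‖x - y‖ 1) - Real.log (‖y‖ + 1)) * f y) /
      Real.log ‖x‖) (cocompact R4) (𝓝 (∫ y, f y)) := by
  simp_rw [← integral_div]
  refine tendsto_integral_filter_of_dominated_convergence (fun y => 2 * ‖f y‖)
    (Eventually.of_forall fun x => Measurable.aestronglyMeasurable (by fun_prop)) ?_
    (hfi.norm.const_mul 2) (Eventually.of_forall fun y => ?_)
  · filter_upwards [eventually_cocompact_le_norm 2] with x hx
    refine Eventually.of_forall fun y => ?_
    have hL : 0 < Real.log ‖x‖ := Real.log_pos (by linarith)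
    -- For `|x| ≥ 2`, `|x| + 2 ≤ |x|²`.
    have h1 : Real.log (‖x‖ + 2) ≤ 2 * Real.log ‖x‖ := by
      rw [← Real.log_rpow (by linarith)]
      refine Real.log_le_log (by linarith) ?_
      norm_num
      nlinarith
    have h2 : Real.log (max ‖x - y‖ 1) - Real.log (‖y‖ + 1) ≤ Real.log (‖x‖ + 2) := by
      have h0 : 0 < max ‖x - y‖ 1 := lt_of_lt_of_le one_pos (le_max_right _ _)
      rw [sub_le_iff_le_add, ← Real.log_mul (by positivity) (by positivity)]
      refine Real.log_le_log h0 ((max_norm_sub_one_le x y).trans ?_)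
      gcongr
      norm_num
    have h3 := log_norm_add_one_sub_le x y
    have h4 : |Real.log (max ‖x - y‖ 1) - Real.log (‖y‖ + 1)| ≤ 2 * Real.log ‖x‖ := by
      rw [abs_le]; constructor <;> linarith
    rw [norm_div, norm_mul, Real.norm_of_nonneg hL.le, div_le_iff₀ hL, Real.norm_eq_abs]
    calc _ ≤ 2 * Real.log ‖x‖ * ‖f y‖ := by gcongr
      _ = _ := by ring
  · have h1 : Tendsto (fun x : R4 => (Real.log (max ‖x - y‖ 1) - Real.log (‖y‖ + 1)) /
        Real.log ‖x‖) (cocompact R4) (𝓝 1) := by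
      rw [tendsto_iff_norm_sub_tendsto_zero]
      have h2 : Tendsto (fun x : R4 => 2 * Real.log (‖y‖ + 1) / Real.log ‖x‖) (cocompact R4)
          (𝓝 0) := tendsto_log_norm_cocompact.const_div_atTop _
      refine squeeze_zero' (Eventually.of_forall fun x => norm_nonneg _) ?_ h2
      filter_upwards [eventually_cocompact_le_norm 2] with x hx
      have hL : 0 < Real.log ‖x‖ := Real.log_pos (by linarith)
      have hx0 : 0 < ‖x‖ := by linarith
      have h0 : 0 < max ‖x - y‖ 1 := lt_of_lt_of_le one_pos (le_max_right _ _)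
      have hy := norm_nonneg y
      have h3 : Real.log (max ‖x - y‖ 1) ≤ Real.log ‖x‖ + Real.log (‖y‖ + 1) := by
        rw [← Real.log_mul hx0.ne' (by positivity)]
        refine Real.log_le_log h0 (max_le ((norm_sub_le _ _).trans ?_) ?_) <;> nlinarith
      have h4 : Real.log ‖x‖ ≤ Real.log (max ‖x - y‖ 1) + Real.log (‖y‖ + 1) := by
        rw [← Real.log_mul h0.ne' (by positivity)]
        refine Real.log_le_log hx0 ?_
        have h5 : ‖x‖ ≤ ‖y‖ + ‖x - y‖ := by
          rw [norm_sub_rev]; exact norm_le_norm_add_norm_sub y x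
        nlinarith [le_max_left ‖x - y‖ 1, le_max_right ‖x - y‖ 1]
      have h6 := Real.log_nonneg (show 1 ≤ ‖y‖ + 1 by linarith)
      rw [div_sub_one hL.ne', norm_div, Real.norm_of_nonneg hL.le, Real.norm_eq_abs]
      gcongr
      rw [abs_le]
      constructor <;> linarith
    have h7 := h1.mul_const (f y)
    rw [one_mul] at h7
    exact h7.congr fun x => by ring

/-- A local `L^s` bound of polynomial growth makes the singular part of the logarithmic potential
negligible against `ln |x|`. -/
lemma tendsto_negLog_potential_div {f : R4 → ℝ} (hf : Continuous f) (hfi : Integrable f)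
    (hf0 : ∀ y, 0 ≤ f y) {s A C : ℝ} (hs : 1 < s) (hC : 0 ≤ C)
    (h : ∀ᶠ x in cocompact R4,
      ∫ y in Metric.ball x 1, f y ^ s ≤ A * Real.exp (C * Real.log ‖x‖)) :
    Tendsto (fun x : R4 => (∫ y, negLog ‖x - y‖ * f y) / Real.log ‖x‖) (cocompact R4) (𝓝 0) := by
  -- `δ = 1 - 1/s` is the exponent conjugate to `1/s` in Young's inequality.
  set δ := (s - 1) / s with hδ
  have hs0 : 0 < s := by linarith
  have hδ0 : 0 < δ := div_pos (by linarith) hs0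
  set ρ : R4 → ℝ := (Metric.ball (0 : R4) 1).indicator fun z => ‖z‖⁻¹ with hρ
  set K := ∫ z, ρ z with hK
  have hpt : ∀ d L a : ℝ, 0 < d → d < 1 → 0 ≤ L → 0 ≤ a → negLog d * a ≤
      C / δ * L * a + 1 / δ * Real.exp (-(C * L)) * (d⁻¹ + a ^ s) := by
    intro d L a hd hd1 hL ha
    rw [negLog_of_le_one hd.le hd1.le]
    -- From `t + 1 ≤ eᵗ` with `t = -δ log d - C L`. The factor `e^{-CL}` is tuned to cancel the
    -- polynomial growth of the `L^s` norm, while the price `(C/δ) L` multiplies only the mass of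
    -- `f` on `B(x,1)`, which tends to `0`.
    have h1 : -Real.log d ≤ C / δ * L + 1 / δ * (Real.exp (-(C * L)) * (d⁻¹) ^ δ) := by
      have h2 := Real.add_one_le_exp (δ * (-Real.log d - C / δ * L))
      have h3 : Real.exp (δ * (-Real.log d - C / δ * L)) =
          Real.exp (-(C * L)) * (d⁻¹) ^ δ := by
        rw [Real.rpow_def_of_pos (by positivity), Real.log_inv, ← Real.exp_add]
        congr 1
        field_simp
        ring
      rw [h3] at h2
      have h4 : -Real.log d = C / δ * L + 1 / δ * (δ * (-Real.log d - C / δ * L)) := by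
        field_simp
        ring
      have h5 : 1 / δ * (δ * (-Real.log d - C / δ * L)) ≤
          1 / δ * (Real.exp (-(C * L)) * (d⁻¹) ^ δ) :=
        mul_le_mul_of_nonneg_left (by linarith) (by positivity)
      linarith
    have h5 : (d⁻¹) ^ δ * a ≤ d⁻¹ + a ^ s := by
      have h6 := Real.geom_mean_le_arith_mean2_weighted (w₁ := δ) (w₂ := 1 / s) (p₁ := d⁻¹)
        (p₂ := a ^ s) hδ0.le (by positivity) (by positivity) (by positivity)
        (by rw [hδ]; field_simp; ring)
      rw [← Real.rpow_mul ha, mul_one_div_cancel hs0.ne', Real.rpow_one] at h6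
      have h7 : δ * d⁻¹ ≤ d⁻¹ := mul_le_of_le_one_left (by positivity)
        (by rw [hδ, div_le_one hs0]; linarith)
      have h8 : 1 / s * a ^ s ≤ a ^ s := mul_le_of_le_one_left (by positivity)
        (by rw [div_le_one hs0]; linarith)
      linarith
    calc -Real.log d * a ≤ (C / δ * L + 1 / δ * (Real.exp (-(C * L)) * (d⁻¹) ^ δ)) * a := by gcongr
      _ = C / δ * L * a + 1 / δ * Real.exp (-(C * L)) * ((d⁻¹) ^ δ * a) := by ring
      _ ≤ _ := by gcongr
  have hb : ∀ᶠ x in cocompact R4, (∫ y, negLog ‖x - y‖ * f y) / Real.log ‖x‖ ≤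
      C / δ * (∫ y in Metric.ball x 1, f y) + (1 / δ * (K + A)) / Real.log ‖x‖ := by
    filter_upwards [h, eventually_cocompact_le_norm 2] with x hx hx2
    set L := Real.log ‖x‖ with hLdef
    have hL : 0 < L := Real.log_pos (by linarith)
    have hfs : IntegrableOn (fun y => f y ^ s) (Metric.ball x 1) := by
      have hc : Continuous fun y => f y ^ s := hf.rpow_const fun y => Or.inr hs0.le
      exact (hc.continuousOn.integrableOn_compact (isCompact_closedBall x 1)).mono_set
        Metric.ball_subset_closedBall
    have i1 : Integrable ((Metric.ball x 1).indicator f) := hfi.indicator measurableSet_ball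
    have i2 : Integrable ((Metric.ball x 1).indicator fun y => f y ^ s) :=
      (integrable_indicator_iff measurableSet_ball).2 hfs
    have i3 : Integrable fun y => ρ (x - y) := integrable_indicator_inv_norm.comp_sub_left x
    have i4 : Integrable fun y => ρ (x - y) +
        (Metric.ball x 1).indicator (fun y => f y ^ s) y := i3.add i2
    have hle : ∫ y, negLog ‖x - y‖ * f y ≤ ∫ y, (C / δ * L * (Metric.ball x 1).indicator f y +
        1 / δ * Real.exp (-(C * L)) * (ρ (x - y) +
          (Metric.ball x 1).indicator (fun y => f y ^ s) y)) := by
      refine integral_mono_ae (integrable_negLog_mul hf hfi x)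
        ((i1.const_mul _).add (i4.const_mul _)) ?_
      filter_upwards [Measure.ae_ne volume x] with y hy
      have hd : 0 < ‖x - y‖ := norm_sub_pos_iff.2 hy.symm
      by_cases hb : ‖x - y‖ < 1
      · have m1 : y ∈ Metric.ball x 1 := by rwa [Metric.mem_ball, dist_comm, dist_eq_norm]
        have m2 : x - y ∈ Metric.ball (0 : R4) 1 := by simpa using hb
        simp only [hρ, Set.indicator_of_mem m1, Set.indicator_of_mem m2]
        exact hpt _ L (f y) hd hb hL.le (hf0 y)
      · have m1 : y ∉ Metric.ball x 1 := by rwa [Metric.mem_ball, dist_comm, dist_eq_norm]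
        have m2 : x - y ∉ Metric.ball (0 : R4) 1 := by simpa using hb
        simp [hρ, Set.indicator_of_notMem m1, Set.indicator_of_notMem m2,
          negLog_of_one_le (not_lt.1 hb)]
    have hval : ∫ y, (C / δ * L * (Metric.ball x 1).indicator f y +
        1 / δ * Real.exp (-(C * L)) * (ρ (x - y) +
          (Metric.ball x 1).indicator (fun y => f y ^ s) y)) =
        C / δ * L * (∫ y in Metric.ball x 1, f y) + 1 / δ * Real.exp (-(C * L)) *
          (K + ∫ y in Metric.ball x 1, f y ^ s) := by
      rw [integral_add (i1.const_mul _) (i4.const_mul _), integral_const_mul,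
        integral_const_mul, integral_add i3 i2, integral_indicator measurableSet_ball,
        integral_indicator measurableSet_ball, integral_sub_left_eq_self ρ volume x]
    rw [hval] at hle
    have hK0 : 0 ≤ K := integral_nonneg fun z => Set.indicator_nonneg (fun _ _ => by positivity) _
    have h9 : Real.exp (-(C * L)) * (K + ∫ y in Metric.ball x 1, f y ^ s) ≤ K + A := by
      have h10 : Real.exp (-(C * L)) ≤ 1 := by
        rw [Real.exp_le_one_iff]; nlinarith
      calc _ ≤ Real.exp (-(C * L)) * (K + A * Real.exp (C * L)) := by gcongr
        _ = Real.exp (-(C * L)) * K + A := by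
            rw [mul_add, mul_left_comm, ← Real.exp_add]; simp
        _ ≤ _ := by nlinarith
    rw [div_le_iff₀ hL, add_mul, div_mul_cancel₀ _ hL.ne']
    have h11 : 1 / δ * Real.exp (-(C * L)) * (K + ∫ y in Metric.ball x 1, f y ^ s) ≤
        1 / δ * (K + A) := by
      rw [mul_assoc]; gcongr
    linarith
  have hlim := ((tendsto_setIntegral_ball_cocompact hfi 1).const_mul (C / δ)).add
    (tendsto_log_norm_cocompact.const_div_atTop (1 / δ * (K + A)))
  rw [mul_zero, zero_add] at hlim
  refine squeeze_zero' ?_ hb hlim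
  filter_upwards [eventually_cocompact_le_norm 2] with x hx
  exact div_nonneg (integral_nonneg fun y => mul_nonneg (negLog_nonneg _) (hf0 y))
    (Real.log_nonneg (by linarith))

lemma integrable_log_max_kernel {f : R4 → ℝ} (hf : Continuous f) (hfi : Integrable f) (x : R4) :
    Integrable fun y => (Real.log (max ‖x - y‖ 1) - Real.log (‖y‖ + 1)) * f y := by
  refine ((integrable_log_kernel hf hfi x).add (integrable_negLog_mul hf hfi x)).congr
    (Eventually.of_forall fun y => ?_)
  simp only [Pi.add_apply]
  rw [log_eq_log_max_sub_negLog (norm_nonneg (x - y))]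
  ring

lemma log_potential_eq {f : R4 → ℝ} (hf : Continuous f) (hfi : Integrable f) (x : R4) :
    ∫ y, (Real.log ‖x - y‖ - Real.log (‖y‖ + 1)) * f y =
      (∫ y, (Real.log (max ‖x - y‖ 1) - Real.log (‖y‖ + 1)) * f y) -
        ∫ y, negLog ‖x - y‖ * f y := by
  rw [← integral_sub (integrable_log_max_kernel hf hfi x) (integrable_negLog_mul hf hfi x)]
  refine integral_congr_ae (Eventually.of_forall fun y => ?_)
  simp only
  rw [log_eq_log_max_sub_negLog (norm_nonneg (x - y))]
  ring

lemma tendsto_div_log_of_local_bound {v f : R4 → ℝ} (hf : Continuous f) (hfi : Integrable f)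
    (hf0 : ∀ y, 0 ≤ f y) {c c₀ : ℝ}
    (hv : ∀ x, v x = c * (∫ y, (Real.log ‖x - y‖ - Real.log (‖y‖ + 1)) * f y) + c₀)
    {s A C : ℝ} (hs : 1 < s) (hC : 0 ≤ C)
    (h : ∀ᶠ x in cocompact R4,
      ∫ y in Metric.ball x 1, f y ^ s ≤ A * Real.exp (C * Real.log ‖x‖)) :
    Tendsto (fun x => v x / Real.log ‖x‖) (cocompact R4) (𝓝 (c * ∫ y, f y)) := by
  have h1 := (((tendsto_log_max_potential_div hf hfi).sub
    (tendsto_negLog_potential_div hf hfi hf0 hs hC h)).const_mul c).add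
    (tendsto_log_norm_cocompact.const_div_atTop c₀)
  rw [sub_zero, add_zero] at h1
  refine h1.congr fun x => ?_
  rw [hv, log_potential_eq hf hfi]
  ring

/-! ### Local bound under the second alternative -/

lemma log_norm_le_of_mem_ball {x y : R4} (hx : 2 ≤ ‖x‖) (hy : y ∈ Metric.ball x 1) :
    Real.log ‖y‖ ≤ 2 * Real.log ‖x‖ := by
  rw [Metric.mem_ball, dist_eq_norm] at hy
  have h1 : ‖y‖ ≤ ‖x‖ + ‖y - x‖ := by
    rw [norm_sub_rev]; exact norm_le_norm_add_norm_sub _ _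
  have h2 : ‖x‖ ≤ ‖y‖ + ‖y - x‖ := by
    rw [norm_sub_rev]
    have := norm_le_norm_add_norm_sub y x
    rwa [norm_sub_rev] at this
  rw [← Real.log_rpow (by linarith)]
  refine Real.log_le_log (by linarith) ?_
  norm_num
  nlinarith

lemma integrableOn_ball_of_continuous {h : R4 → ℝ} (hh : Continuous h) (x : R4) (R : ℝ) :
    IntegrableOn h (Metric.ball x R) :=
  (hh.continuousOn.integrableOn_compact (isCompact_closedBall x R)).mono_set
    Metric.ball_subset_closedBall

/-- The local bound under the second alternative assumption. -/
lemma local_bound_of_H2 {p q : ℝ} (hp : 0 < p) (hq : 0 ≤ q) {u v : R4 → ℝ}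
    (hu0 : ∀ x, 0 < u x) (huc : Continuous u) (hvc : Continuous v) (h : AssumptionH2 p u v) :
    ∃ s A C : ℝ, 1 < s ∧ 0 ≤ C ∧ ∀ᶠ x in cocompact R4,
      ∫ y in Metric.ball x 1, nonlin p q u v y ^ s ≤ A * Real.exp (C * Real.log ‖x‖) := by
  obtain ⟨⟨τ, hτ, hi⟩, hO⟩ := h
  obtain ⟨B, hB0, hB⟩ := hO.exists_pos
  have hs : 1 < τ / p := (one_lt_div hp).2 hτ
  have hs0 : 0 < τ / p := by linarith
  -- The power `s = τ/p` turns `u^p` into `u^τ`; the factor `2` comes from `log|y| ≤ 2 log|x|` on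
  -- the unit ball about `x`.
  refine ⟨τ / p, ∫ x, u x ^ τ, q * (τ / p) * (B * 2), hs, by positivity, ?_⟩
  have hev := eventually_cocompact_ball (hB.bound.and (eventually_cocompact_le_norm 1)) 1
  filter_upwards [hev, eventually_cocompact_le_norm 2] with x hx hx2
  have hpt : ∀ y ∈ Metric.ball x 1, nonlin p q u v y ^ (τ / p) ≤
      u y ^ τ * Real.exp (q * (τ / p) * (B * 2) * Real.log ‖x‖) := by
    intro y hy
    obtain ⟨h1, h2⟩ := hx y hy
    have hL : 0 ≤ Real.log ‖y‖ := Real.log_nonneg h2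
    rw [Real.norm_eq_abs, Real.norm_of_nonneg hL] at h1
    have h3 : v y ≤ B * 2 * Real.log ‖x‖ := by
      have := log_norm_le_of_mem_ball hx2 hy
      have h4 := le_abs_self (v y)
      nlinarith
    unfold nonlin
    rw [Real.mul_rpow (Real.rpow_nonneg (hu0 y).le _) (Real.exp_pos _).le,
      ← Real.rpow_mul (hu0 y).le, mul_div_cancel₀ _ hp.ne', ← Real.exp_mul]
    refine mul_le_mul_of_nonneg_left (Real.exp_le_exp.2 ?_) (Real.rpow_nonneg (hu0 y).le _)
    have h5 : 0 ≤ q * (τ / p) := by positivity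
    nlinarith [mul_le_mul_of_nonneg_left h3 h5]
  calc ∫ y in Metric.ball x 1, nonlin p q u v y ^ (τ / p)
      ≤ ∫ y in Metric.ball x 1,
          u y ^ τ * Real.exp (q * (τ / p) * (B * 2) * Real.log ‖x‖) := by
        refine setIntegral_mono_on ?_ (hi.integrableOn.mul_const _) measurableSet_ball hpt
        exact integrableOn_ball_of_continuous ((continuous_nonlin hu0 huc hvc).rpow_const
          fun y => Or.inr hs0.le) x 1
    _ = (∫ y in Metric.ball x 1, u y ^ τ) *
          Real.exp (q * (τ / p) * (B * 2) * Real.log ‖x‖) := integral_mul_const _ _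
    _ ≤ _ := by
        refine mul_le_mul_of_nonneg_right ?_ (Real.exp_pos _).le
        exact setIntegral_le_integral hi
          (Eventually.of_forall fun y => Real.rpow_nonneg (hu0 y).le _)

/-! ### Exponential estimates and local bound under the first alternative -/

lemma le_log_add_negLog_potential {v f : R4 → ℝ} (hf : Continuous f) (hfi : Integrable f)
    (hf0 : ∀ y, 0 ≤ f y) {a c₀ : ℝ} (ha : 0 ≤ a)
    (hv : ∀ x, v x = -a * (∫ y, (Real.log ‖x - y‖ - Real.log (‖y‖ + 1)) * f y) + c₀) (x : R4) :
    v x ≤ a * (Real.log (‖x‖ + 2) * (∫ y, f y) + ∫ y, negLog ‖x - y‖ * f y) + c₀ := by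
  have h : -(∫ y, (Real.log (max ‖x - y‖ 1) - Real.log (‖y‖ + 1)) * f y) ≤
      Real.log (‖x‖ + 2) * ∫ y, f y := by
    rw [← integral_neg, ← integral_const_mul]
    refine integral_mono (integrable_log_max_kernel hf hfi x).neg (hfi.const_mul _) fun y => ?_
    have := mul_le_mul_of_nonneg_right (log_norm_add_one_sub_le x y) (hf0 y)
    simp only
    linarith
  rw [hv, log_potential_eq hf hfi]
  nlinarith

open scoped Convolution in
/-- The Brezis–Merle estimate for the singular part of the logarithmic potential. -/
lemma exists_integral_exp_negLog_le {f : R4 → ℝ} (hf : Continuous f) (hfi : Integrable f)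
    (hf0 : ∀ y, 0 < f y) : ∃ G : ℝ, 0 ≤ G ∧ ∀ κ : ℝ, 0 ≤ κ → ∀ x₀ : R4,
      κ * (∫ y in Metric.ball x₀ 2, f y) ≤ 1 → ∀ h : R4 → ℝ, Continuous h →
      (∀ x ∈ Metric.ball x₀ 1, h x ≤ κ * ∫ y, negLog ‖x - y‖ * f y) →
      ∫ x in Metric.ball x₀ 1, Real.exp (h x) ≤ G := by
  -- `g` dominates `exp (negLog |z|)` for `0 < |z| < 3`, a range containing `x - y` for distinct `x
  -- ∈ B(x₀,1)`, `y ∈ B(x₀,2)`. It depends on neither `x₀` nor `κ`, hence neither does `G = ∫ g`.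
  set g : R4 → ℝ := (Metric.ball (0 : R4) 3).indicator 1 +
    ((Metric.ball (0 : R4) 1).indicator (fun z => ‖z‖⁻¹)) with hg
  have hgi : Integrable g :=
    ((integrable_indicator_iff measurableSet_ball).2
      (integrableOn_ball_of_continuous continuous_one 0 3)).add integrable_indicator_inv_norm
  have hg0 : ∀ z, 0 ≤ g z := fun z => add_nonneg
    (Set.indicator_nonneg (fun _ _ => by simp) _) (Set.indicator_nonneg (fun _ _ => by positivity) _)
  refine ⟨∫ z, g z, integral_nonneg hg0, fun κ hκ x₀ hM1 h hh hle => ?_⟩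
  set M := ∫ y in Metric.ball x₀ 2, f y with hM
  have hM0 : 0 < M := by
    rw [hM, integral_pos_iff_support_of_nonneg (fun y => (hf0 y).le) hfi.integrableOn]
    have : Function.support f = Set.univ := by
      ext y; simp [(hf0 y).ne']
    rw [this, Measure.restrict_apply_univ]
    exact Metric.measure_ball_pos _ _ two_pos
  set f₁ := (Metric.ball x₀ 2).indicator f with hf₁
  have hf₁i : Integrable f₁ := hfi.indicator measurableSet_ball
  have hf₁0 : ∀ y, 0 ≤ f₁ y := fun y => Set.indicator_nonneg (fun y _ => (hf0 y).le) _
  have hconv := hf₁i.integrable_convolution (ContinuousLinearMap.mul ℝ ℝ) hgi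
  have hconv_eq : ∀ x, (f₁ ⋆[ContinuousLinearMap.mul ℝ ℝ, volume] g) x =
      ∫ y, f₁ y * g (x - y) := fun x => rfl
  have hint := integral_convolution (μ := volume) (ν := volume)
    (ContinuousLinearMap.mul ℝ ℝ) hf₁i hgi
  have hf₁M : ∫ y, f₁ y = M := integral_indicator measurableSet_ball
  rw [ContinuousLinearMap.mul_apply', hf₁M] at hint
  have hae : ∀ᵐ x : R4, Integrable fun y => f₁ y * g (x - y) :=
    hf₁i.ae_convolution_exists (ContinuousLinearMap.mul ℝ ℝ) hgi
  have hpt : ∀ᵐ x : R4, x ∈ Metric.ball x₀ 1 → Real.exp (h x) ≤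
      M⁻¹ * (f₁ ⋆[ContinuousLinearMap.mul ℝ ℝ, volume] g) x := by
    filter_upwards [hae] with x hxi hx
    set N := ∫ y, negLog ‖x - y‖ * f y with hN
    have hN1 : N = ∫ y, negLog ‖x - y‖ * f₁ y := by
      refine integral_congr_ae (Eventually.of_forall fun y => ?_)
      simp only
      by_cases hy : y ∈ Metric.ball x₀ 2
      · rw [hf₁, Set.indicator_of_mem hy]
      · rw [hf₁, Set.indicator_of_notMem hy, negLog_of_one_le]
        · simp
        · rw [← dist_eq_norm, dist_comm]
          rw [Metric.mem_ball] at hx hy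
          have := dist_triangle y x x₀
          linarith
    have hNi : Integrable fun y => negLog ‖x - y‖ * f₁ y := by
      refine ((integrable_negLog_mul hf hfi x).indicator
        (measurableSet_ball (x := x₀) (ε := 2))).congr (Eventually.of_forall fun y => ?_)
      by_cases hy : y ∈ Metric.ball x₀ 2
      · simp only [hf₁, Set.indicator_of_mem hy]
      · simp only [hf₁, Set.indicator_of_notMem hy, mul_zero]
    -- Jensen's inequality for the probability density `f₁/M`, obtained by integrating the tangent
    -- line of `exp` at the mean `κN` of `κM negLog`. The condition `κM ≤ 1` then reduces the
    -- exponent to `negLog`.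
    have h1 : Real.exp (κ * N) * M ≤ ∫ y, f₁ y * g (x - y) := by
      have h2 : ∫ y, (Real.exp (κ * N) * ((1 - κ * N) * f₁ y) +
          Real.exp (κ * N) * (κ * M * (negLog ‖x - y‖ * f₁ y))) = Real.exp (κ * N) * M := by
        rw [integral_add ((hf₁i.const_mul _).const_mul _) ((hNi.const_mul _).const_mul _),
          integral_const_mul, integral_const_mul, integral_const_mul, integral_const_mul, hf₁M,
          ← hN1]
        ring
      rw [← h2]
      refine integral_mono_ae (((hf₁i.const_mul _).const_mul _).add
        ((hNi.const_mul _).const_mul _)) hxi ?_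
      filter_upwards [Measure.ae_ne volume x] with y hyx
      have hd : 0 < ‖x - y‖ := norm_sub_pos_iff.2 hyx.symm
      by_cases hy : y ∈ Metric.ball x₀ 2
      · have hfy := hf₁0 y
        have hg1 : Real.exp (negLog ‖x - y‖) ≤ g (x - y) := by
          have hm3 : x - y ∈ Metric.ball (0 : R4) 3 := by
            rw [mem_ball_zero_iff, ← dist_eq_norm]
            rw [Metric.mem_ball] at hx hy
            have := dist_triangle_right x y x₀
            linarith
          simp only [hg, Pi.add_apply, Set.indicator_of_mem hm3, Pi.one_apply]
          by_cases hb : ‖x - y‖ < 1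
          · have hm1 : x - y ∈ Metric.ball (0 : R4) 1 := by simpa using hb
            rw [Set.indicator_of_mem hm1]
            exact exp_negLog_le hd
          · have hm1 : x - y ∉ Metric.ball (0 : R4) 1 := by simpa using hb
            rw [Set.indicator_of_notMem hm1, negLog_of_one_le (not_lt.1 hb)]
            simp
        have h3 : Real.exp (κ * M * negLog ‖x - y‖) ≤ Real.exp (negLog ‖x - y‖) :=
          Real.exp_le_exp.2 (mul_le_of_le_one_left (negLog_nonneg _) hM1)
        have h4 : Real.exp (κ * N) * (1 - κ * N + κ * M * negLog ‖x - y‖) ≤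
            Real.exp (κ * M * negLog ‖x - y‖) := by
          have h5 := Real.add_one_le_exp (κ * M * negLog ‖x - y‖ - κ * N)
          have h6 : Real.exp (κ * M * negLog ‖x - y‖) = Real.exp (κ * N) *
              Real.exp (κ * M * negLog ‖x - y‖ - κ * N) := by
            rw [← Real.exp_add]; congr 1; ring
          rw [h6]
          exact mul_le_mul_of_nonneg_left (by linarith) (Real.exp_pos _).le
        calc _ = f₁ y * (Real.exp (κ * N) * (1 - κ * N + κ * M * negLog ‖x - y‖)) := by ring
          _ ≤ f₁ y * g (x - y) := by gcongr; linarith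
      · simp [hf₁, Set.indicator_of_notMem hy]
    rw [hconv_eq, ← div_eq_inv_mul, le_div_iff₀ hM0]
    refine le_trans ?_ h1
    exact mul_le_mul_of_nonneg_right (Real.exp_le_exp.2 (hle x hx)) hM0.le
  -- By Fubini the convolution integrates to `M ∫ g`, so the mass `M` cancels.
  calc ∫ x in Metric.ball x₀ 1, Real.exp (h x)
      ≤ ∫ x in Metric.ball x₀ 1, M⁻¹ * (f₁ ⋆[ContinuousLinearMap.mul ℝ ℝ, volume] g) x :=
        setIntegral_mono_on_ae (integrableOn_ball_of_continuous hh.rexp x₀ 1)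
          (hconv.const_mul _).integrableOn measurableSet_ball hpt
    _ ≤ ∫ x, M⁻¹ * (f₁ ⋆[ContinuousLinearMap.mul ℝ ℝ, volume] g) x := by
        refine setIntegral_le_integral (hconv.const_mul _) (Eventually.of_forall fun x => ?_)
        exact mul_nonneg (by positivity)
          (integral_nonneg fun y => mul_nonneg (hf₁0 y) (hg0 _))
    _ = ∫ z, g z := by
        rw [integral_const_mul, hint, inv_mul_cancel_left₀ hM0.ne']

lemma log_norm_add_two_le {x y : R4} (hx : 3 ≤ ‖x‖) (hy : y ∈ Metric.ball x 1) :
    Real.log (‖y‖ + 2) ≤ 2 * Real.log ‖x‖ := by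
  rw [Metric.mem_ball, dist_eq_norm] at hy
  have h1 : ‖y‖ ≤ ‖x‖ + ‖y - x‖ := by
    rw [norm_sub_rev]; exact norm_le_norm_add_norm_sub _ _
  rw [← Real.log_rpow (by linarith)]
  refine Real.log_le_log (by positivity) ?_
  norm_num
  nlinarith

/-- Exponential integrability of `v` on unit balls, with polynomially growing bounds. -/
lemma exists_integral_exp_le {v f : R4 → ℝ} (hvc : Continuous v) (hf : Continuous f)
    (hfi : Integrable f) (hf0 : ∀ y, 0 < f y) {a c₀ : ℝ} (ha : 0 ≤ a)
    (hv : ∀ x, v x = -a * (∫ y, (Real.log ‖x - y‖ - Real.log (‖y‖ + 1)) * f y) + c₀)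
    {k : ℝ} (hk : 0 ≤ k) :
    ∃ A C : ℝ, 0 ≤ A ∧ 0 ≤ C ∧ ∀ᶠ x in cocompact R4,
      ∫ y in Metric.ball x 1, Real.exp (k * v y) ≤ A * Real.exp (C * Real.log ‖x‖) := by
  obtain ⟨G, hG0, hG⟩ := exists_integral_exp_negLog_le hf hfi hf0
  have hI : 0 ≤ ∫ y, f y := integral_nonneg fun y => (hf0 y).le
  refine ⟨G * Real.exp (k * c₀), k * a * (2 * ∫ y, f y), by positivity, by positivity, ?_⟩
  -- The mass of `f` on `B(x,2)` tends to `0`, so the smallness condition holds far out for every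
  -- fixed `k`.
  have h1 := (tendsto_setIntegral_ball_cocompact hfi 2).const_mul (k * a)
  rw [mul_zero] at h1
  filter_upwards [h1.eventually_le_const one_pos, eventually_cocompact_le_norm 3] with x hx hx3
  -- `b` bounds the contribution of the nonsingular part and of `c₀` to `k v` on the ball; `e^b` is
  -- the polynomial factor.
  set b := k * (a * (2 * Real.log ‖x‖ * ∫ y, f y) + c₀) with hb
  have h2 := hG (k * a) (by positivity) x hx (fun y => k * v y - b) (by fun_prop) fun y hy => by
    have h3 := le_log_add_negLog_potential hf hfi (fun y => (hf0 y).le) ha hv y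
    have h4 : Real.log (‖y‖ + 2) * (∫ y, f y) ≤ 2 * Real.log ‖x‖ * ∫ y, f y :=
      mul_le_mul_of_nonneg_right (log_norm_add_two_le hx3 hy) hI
    have h5 := mul_le_mul_of_nonneg_left h3 hk
    have h6 := mul_le_mul_of_nonneg_left h4 (mul_nonneg hk ha)
    rw [hb]
    linarith
  have h7 : ∀ y, Real.exp (k * v y) = Real.exp b * Real.exp (k * v y - b) := fun y => by
    rw [← Real.exp_add]; congr 1; ring
  simp_rw [h7]
  rw [integral_const_mul]
  calc _ ≤ Real.exp b * G := by gcongr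
    _ = _ := by
      rw [mul_assoc G, ← Real.exp_add, mul_comm G, hb]
      congr 2
      ring

/-- Young's inequality with weights `1/4, 1/8, 5/8`: it uses the available `u⁴`, an exponential
power that can be controlled, and `|y|^{-16/5}`, still integrable near `0` since `16/5 < 4`. -/
lemma one_add_mul_mul_le {a b d : ℝ} (ha : 0 ≤ a) (hb : 0 ≤ b) (hd : 0 < d) :
    (1 + a) * b * (1 / d ^ 2) ≤ 8 * (1 + a ^ 4) + b ^ 8 + d ^ (-(16 / 5) : ℝ) := by
  have h1 := Real.geom_mean_le_arith_mean3_weighted (w₁ := 1 / 4) (w₂ := 1 / 8) (w₃ := 5 / 8)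
    (p₁ := (1 + a) ^ 4) (p₂ := b ^ 8) (p₃ := d ^ (-(16 / 5) : ℝ)) (by norm_num) (by norm_num)
    (by norm_num) (by positivity) (by positivity) (by positivity) (by norm_num)
  have e1 : ((1 + a) ^ 4) ^ (1 / 4 : ℝ) = 1 + a := by
    rw [← Real.rpow_natCast, ← Real.rpow_mul (by positivity)]
    norm_num
  have e2 : (b ^ 8) ^ (1 / 8 : ℝ) = b := by
    rw [← Real.rpow_natCast, ← Real.rpow_mul hb]
    norm_num
  have e3 : (d ^ (-(16 / 5) : ℝ)) ^ (5 / 8 : ℝ) = 1 / d ^ 2 := by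
    rw [← Real.rpow_mul hd.le, one_div, ← Real.rpow_natCast, ← Real.rpow_neg hd.le]
    norm_num
  rw [e1, e2, e3] at h1
  have h2 : (1 + a) ^ 4 ≤ 8 * (1 + a ^ 4) := by
    nlinarith [sq_nonneg (a - 1), sq_nonneg (a ^ 2 - 1), mul_nonneg ha (sq_nonneg (a - 1)),
      sq_nonneg (a * (a - 1)), sq_nonneg (a + 1)]
  have h3 : 0 ≤ (1 + a) ^ 4 := by positivity
  have h4 : 0 ≤ b ^ 8 := by positivity
  have h5 : 0 < d ^ (-(16 / 5) : ℝ) := by positivity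
  linarith

lemma setIntegral_ball_translate (h : R4 → ℝ) (x : R4) :
    ∫ y in Metric.ball 0 1, h (x + y) = ∫ y in Metric.ball x 1, h y := by
  rw [← integral_indicator measurableSet_ball, ← integral_indicator measurableSet_ball,
    ← integral_add_left_eq_self ((Metric.ball x 1).indicator h) x]
  refine integral_congr_ae (Eventually.of_forall fun y => ?_)
  have hiff : x + y ∈ Metric.ball x 1 ↔ y ∈ Metric.ball 0 1 := by simp
  by_cases hy : y ∈ Metric.ball (0 : R4) 1
  · simp only [Set.indicator_of_mem hy, Set.indicator_of_mem (hiff.2 hy)]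
  · simp only [Set.indicator_of_notMem hy, Set.indicator_of_notMem fun h' => hy (hiff.1 h')]

/-- Polynomial growth of `u` when `u⁴` is integrable. -/
lemma exists_le_exp_log {p q : ℝ} (hp : 0 ≤ p) (hp1 : p < 1) {u v : R4 → ℝ}
    (hu : ContDiff ℝ 2 u) (hu0 : ∀ x, 0 < u x) (hvc : Continuous v)
    (hΔ : ∀ x, -(Δ u) x = nonlin p q u v x) (hgi : Integrable (nonlin p q u v))
    (hu4 : Integrable fun x => u x ^ 4) {A C : ℝ} (hC : 0 ≤ C)
    (h : ∀ᶠ x in cocompact R4,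
      ∫ y in Metric.ball x 1, Real.exp (8 * q * v y) ≤ A * Real.exp (C * Real.log ‖x‖)) :
    ∃ A', 0 ≤ A' ∧ ∀ᶠ x in cocompact R4, u x ≤ A' * Real.exp (C * Real.log ‖x‖) := by
  have hω := omega3_pos
  have hg : Continuous (nonlin p q u v) := continuous_nonlin hu0 hu.continuous hvc
  have hK := integrableOn_rpow_norm_ball (a := -(16 / 5)) (by norm_num)
  set K := ∫ z in Metric.ball (0 : R4) 1, ‖z‖ ^ (-(16 / 5) : ℝ) with hKdef
  have hK0 : 0 ≤ K := integral_nonneg fun z => Real.rpow_nonneg (norm_nonneg _) _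
  set V := (volume : Measure R4).real (Metric.ball 0 1) with hV
  have hV0 : 0 ≤ V := measureReal_nonneg
  set I := ∫ x, u x ^ 4 with hI
  have hI0 : 0 ≤ I := integral_nonneg fun x => by positivity
  refine ⟨12 / omega3 * (omega3 / 12 + I + (8 * (V + I) + |A| + K)), by positivity, ?_⟩
  filter_upwards [h, eventually_cocompact_le_norm 1] with x hx hx1
  have hE : 1 ≤ Real.exp (C * Real.log ‖x‖) :=
    Real.one_le_exp (mul_nonneg hC (Real.log_nonneg hx1))
  set E := Real.exp (C * Real.log ‖x‖)
  have h1 := wmean_add_integral_eq one_ne_zero hu hΔ hgi x one_pos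
  rw [integral_bump_one] at h1
  -- By `u ≤ 1 + u⁴` the mean of `u` over a unit ball is bounded uniformly in its centre.
  have h2 : wmean 1 u x 1 ≤ omega3 / 12 + I := by
    rw [← integral_bump_one, hI, ← integral_add_left_eq_self (fun y => u y ^ 4) x,
      ← integral_add (integrable_bump one_ne_zero) (hu4.comp_add_left x)]
    refine integral_mono (integrable_mul_bump one_ne_zero (hu.continuous.comp (by fun_prop)))
      ((integrable_bump one_ne_zero).add (hu4.comp_add_left x)) fun y => ?_
    have h3 := (hu0 (x + y)).le
    have h4 : u (x + y) ≤ 1 + u (x + y) ^ 4 := by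
      nlinarith [sq_nonneg (u (x + y) - 1), sq_nonneg (u (x + y) ^ 2 - 1)]
    have h5 := bump_nonneg 1 y
    have h6 := bump_le_one 1 y
    have h7 : 0 ≤ u (x + y) ^ 4 := by positivity
    simp only [one_smul]
    nlinarith [mul_le_mul_of_nonneg_right h4 h5]
  have hu4c : Continuous fun y => 8 * (1 + u (x + y) ^ 4) := by
    have := hu.continuous
    fun_prop
  have hevc : Continuous fun y => Real.exp (8 * q * v (x + y)) := by fun_prop
  have i1 := integrableOn_ball_of_continuous hu4c 0 1
  have i2 := integrableOn_ball_of_continuous hevc 0 1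
  have h3 : ∫ y, bump (1 + 2) ((1 : ℝ)⁻¹ • y) * (nonlin p q u v (x + y) / ‖y‖ ^ 2) ≤
      ∫ y in Metric.ball (0 : R4) 1, (8 * (1 + u (x + y) ^ 4) + Real.exp (8 * q * v (x + y)) +
        ‖y‖ ^ (-(16 / 5) : ℝ)) := by
    rw [← integral_indicator measurableSet_ball]
    refine integral_mono_of_nonneg (Eventually.of_forall fun y => mul_nonneg (bump_nonneg _ _)
      (div_nonneg (nonlin_pos hu0 _).le (by positivity)))
      ((integrable_indicator_iff measurableSet_ball).2 ((i1.add i2).add hK)) ?_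
    filter_upwards [Measure.ae_ne volume (0 : R4)] with y hy
    have hd : 0 < ‖y‖ := norm_pos_iff.2 hy
    simp only [inv_one, one_smul]
    by_cases hb : y ∈ Metric.ball (0 : R4) 1
    · rw [Set.indicator_of_mem hb]
      have h4 := (hu0 (x + y)).le
      -- Sublinearity, `0 ≤ p < 1`, keeps this factor within reach of the fourth power of `u`.
      have h5 : u (x + y) ^ p ≤ 1 + u (x + y) := by
        rcases le_total (u (x + y)) 1 with h6 | h6
        · have := Real.rpow_le_one h4 h6 hp
          linarith
        · have := Real.rpow_le_rpow_of_exponent_le h6 hp1.le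
          rw [Real.rpow_one] at this
          linarith
      have h7 : 0 ≤ nonlin p q u v (x + y) / ‖y‖ ^ 2 :=
        div_nonneg (nonlin_pos hu0 _).le (by positivity)
      calc _ ≤ nonlin p q u v (x + y) / ‖y‖ ^ 2 := mul_le_of_le_one_left h7 (bump_le_one _ _)
        _ = u (x + y) ^ p * Real.exp (q * v (x + y)) * (1 / ‖y‖ ^ 2) := by
          unfold nonlin; ring
        _ ≤ (1 + u (x + y)) * Real.exp (q * v (x + y)) * (1 / ‖y‖ ^ 2) := by gcongr
        _ ≤ _ := one_add_mul_mul_le h4 (Real.exp_pos _).le hd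
        _ = _ := by
          rw [← Real.exp_nat_mul]
          push_cast
          ring_nf
    · rw [Set.indicator_of_notMem hb]
      rw [mem_ball_zero_iff, not_lt] at hb
      rw [bump_eq_zero (by norm_num) hb, zero_mul]
  have h4 : ∫ y in Metric.ball (0 : R4) 1, (8 * (1 + u (x + y) ^ 4) +
      Real.exp (8 * q * v (x + y)) + ‖y‖ ^ (-(16 / 5) : ℝ)) ≤ 8 * (V + I) + |A| * E + K := by
    have i12 : IntegrableOn (fun y => 8 * (1 + u (x + y) ^ 4) + Real.exp (8 * q * v (x + y)))
      (Metric.ball 0 1) := i1.add i2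
    rw [integral_add i12 hK, integral_add i1 i2, integral_const_mul,
      integral_add (integrableOn_ball_of_continuous continuous_const 0 1)
        (hu4.comp_add_left x).integrableOn,
      setIntegral_ball_translate (fun y => Real.exp (8 * q * v y)),
      setIntegral_ball_translate (fun y => u y ^ 4)]
    have h5 : ∫ y in Metric.ball x 1, u y ^ 4 ≤ I :=
      setIntegral_le_integral hu4 (Eventually.of_forall fun y => by positivity)
    have h6 : ∫ _ in Metric.ball (0 : R4) 1, (1 : ℝ) = V := by simp [hV]
    rw [h6]
    have h7 : A * E ≤ |A| * E := mul_le_mul_of_nonneg_right (le_abs_self A) (by linarith)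
    linarith
  norm_num at h1 h3
  have h5 : u x = 12 / omega3 * (u x * (omega3 / 12)) := by field_simp
  rw [h5, ← h1, mul_assoc]
  refine mul_le_mul_of_nonneg_left ?_ (by positivity)
  have h8 : 0 ≤ |A| := abs_nonneg A
  have h34 := h3.trans h4
  clear_value K V I E
  generalize wmean 1 u x 1 = W at *
  generalize (∫ y, bump 3 y * (nonlin p q u v (x + y) / ‖y‖ ^ 2)) = J at *
  clear h3 h4
  -- Since `E ≥ 1`, the terms without a factor `E` are absorbed into multiples of `E`.
  have h9 : 0 ≤ (omega3 / 12 + I + (8 * (V + I) + K)) * (E - 1) :=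
    mul_nonneg (by positivity) (by linarith)
  have h10 : 0 ≤ 8 * (V + I) + |A| * E + K := by
    have := mul_nonneg h8 (show 0 ≤ E by linarith)
    linarith
  linarith

/-- The local bound under the first alternative assumption. -/
lemma local_bound_of_polynomial_growth {p q : ℝ} (hp : 0 < p) {u v : R4 → ℝ}
    (hu0 : ∀ x, 0 < u x) (huc : Continuous u) (hvc : Continuous v) {A C A' C' : ℝ}
    (hA : 0 ≤ A) (hC : 0 ≤ C) (hC' : 0 ≤ C')
    (hu : ∀ᶠ x in cocompact R4, u x ≤ A * Real.exp (C * Real.log ‖x‖))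
    (hexp : ∀ᶠ x in cocompact R4,
      ∫ y in Metric.ball x 1, Real.exp (2 * q * v y) ≤ A' * Real.exp (C' * Real.log ‖x‖)) :
    ∃ s A C : ℝ, 1 < s ∧ 0 ≤ C ∧ ∀ᶠ x in cocompact R4,
      ∫ y in Metric.ball x 1, nonlin p q u v y ^ s ≤ A * Real.exp (C * Real.log ‖x‖) := by
  -- With `s = 2`, the polynomial bound on `u` handles `u^{2p}` and `hexp` handles `e^{2qv}`; the
  -- factor in `C * 2` again comes from `log|y| ≤ 2 log|x|`.
  refine ⟨2, A ^ (2 * p) * A', 2 * p * (C * 2) + C', one_lt_two, by positivity, ?_⟩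
  filter_upwards [eventually_cocompact_ball hu 1, hexp, eventually_cocompact_le_norm 2]
    with x hx hxe hx2
  set L := Real.log ‖x‖ with hL
  have hpt : ∀ y ∈ Metric.ball x 1, nonlin p q u v y ^ (2 : ℝ) ≤
      A ^ (2 * p) * Real.exp (2 * p * (C * 2) * L) * Real.exp (2 * q * v y) := by
    intro y hy
    have h1 : u y ≤ A * Real.exp (C * 2 * L) := by
      refine (hx y hy).trans ?_
      have := log_norm_le_of_mem_ball hx2 hy
      rw [mul_assoc C]
      gcongr
    have h2 : u y ^ (2 * p) ≤ A ^ (2 * p) * Real.exp (2 * p * (C * 2) * L) := by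
      refine (Real.rpow_le_rpow (hu0 y).le h1 (by positivity)).trans_eq ?_
      rw [Real.mul_rpow hA (Real.exp_pos _).le, ← Real.exp_mul]
      ring_nf
    unfold nonlin
    rw [Real.mul_rpow (Real.rpow_nonneg (hu0 y).le _) (Real.exp_pos _).le,
      ← Real.rpow_mul (hu0 y).le, ← Real.exp_mul, mul_comm p 2,
      show q * v y * 2 = 2 * q * v y by ring]
    gcongr
  calc ∫ y in Metric.ball x 1, nonlin p q u v y ^ (2 : ℝ)
      ≤ ∫ y in Metric.ball x 1,
          A ^ (2 * p) * Real.exp (2 * p * (C * 2) * L) * Real.exp (2 * q * v y) := by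
        refine setIntegral_mono_on ?_ ?_ measurableSet_ball hpt
        · exact integrableOn_ball_of_continuous ((continuous_nonlin hu0 huc hvc).rpow_const
            fun y => Or.inr zero_le_two) x 1
        · exact integrableOn_ball_of_continuous (by fun_prop) x 1
    _ = A ^ (2 * p) * Real.exp (2 * p * (C * 2) * L) *
          ∫ y in Metric.ball x 1, Real.exp (2 * q * v y) := integral_const_mul _ _
    _ ≤ A ^ (2 * p) * Real.exp (2 * p * (C * 2) * L) * (A' * Real.exp (C' * L)) := by
        gcongr
    _ = _ := by
        rw [add_mul, Real.exp_add]
        ring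

/-! ### Assembly of the theorem -/

theorem lemmab78 (p₁ q₁ p₂ q₂ : ℝ) (hp₁ : 0 ≤ p₁) (hp₁' : p₁ < 1) (hp₂ : 0 < p₂)
    (hq₁ : 0 < q₁) (hq₂ : 0 ≤ q₂) (u v : R4 → ℝ) (huv : IsSolution p₁ q₁ p₂ q₂ u v)
    (hv : v =o[cocompact R4] fun x => ‖x‖ ^ 2) :
    (∃ c₀ : ℝ, ∀ x : R4,
      Integrable (fun y => (Real.log ‖x - y‖ - Real.log (‖y‖ + 1)) * nonlin p₂ q₂ u v y) ∧
      v x = -(1 / (4 * omega3)) *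
        (∫ y, (Real.log ‖x - y‖ - Real.log (‖y‖ + 1)) * nonlin p₂ q₂ u v y) + c₀) ∧
    (∀ x : R4,
      Integrable (fun y => (nonlin p₂ q₂ u v y / ‖x - y‖ ^ 2) • (x - y)) ∧
      HasGradientAt v
        (-(1 / (4 * omega3)) • ∫ y, (nonlin p₂ q₂ u v y / ‖x - y‖ ^ 2) • (x - y)) x) ∧
    (∀ x : R4,
      Integrable (fun y => nonlin p₂ q₂ u v y / ‖x - y‖ ^ 2) ∧
      (Δ v) x = -(1 / (2 * omega3)) * ∫ y, nonlin p₂ q₂ u v y / ‖x - y‖ ^ 2) ∧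
    (AssumptionH1 u v ∨ AssumptionH2 p₂ u v →
      Tendsto (fun x => v x / Real.log ‖x‖) (cocompact R4) (𝓝 (-alphaConst p₂ q₂ u v))) := by
  have hω := omega3_pos
  have hu2 : ContDiff ℝ 2 u := huv.contDiff_u.of_le (by norm_num)
  have hv4 := huv.contDiff_v
  have hu0 := huv.pos
  set f := nonlin p₂ q₂ u v with hf_def
  have hf : Continuous f := continuous_nonlin hu0 hu2.continuous hv4.continuous
  have hfi : Integrable f := huv.integrable_v
  have hf0 : ∀ y, 0 < f y := nonlin_pos hu0
  have hΔ : ∀ x, -(Δ (-(Δ v))) x = f x := huv.eq_v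
  have hmean := tendsto_wmean_abs_div hp₁ hq₁ hu2 hu0 huv.eq_u huv.integrable_u hv4 hΔ hf hfi hv
  have hrep : ∃ c₀ : ℝ, ∀ x : R4, v x = -(1 / (4 * omega3)) *
      (∫ y, (Real.log ‖x - y‖ - Real.log (‖y‖ + 1)) * f y) + c₀ := by
    -- The kernel `log|x-y| - log|y|` is exchanged for the one normalised by `log(|y|+1)`; the
    -- difference does not depend on `x` and goes into `c₀`.
    refine ⟨v 0 + 1 / (4 * omega3) *
      ∫ y, (Real.log ‖0 - y‖ - Real.log (‖y‖ + 1)) * f y, fun x => ?_⟩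
    have h1 := sub_eq_integral_log hv4 hΔ hf hfi hv hmean x
    have h2 : ∫ y, (Real.log ‖x - y‖ - Real.log ‖0 - y‖) * f y =
        (∫ y, (Real.log ‖x - y‖ - Real.log (‖y‖ + 1)) * f y) -
          ∫ y, (Real.log ‖0 - y‖ - Real.log (‖y‖ + 1)) * f y := by
      rw [← integral_sub (integrable_log_kernel hf hfi x) (integrable_log_kernel hf hfi 0)]
      exact integral_congr_ae (Eventually.of_forall fun y => by simp only; ring)
    rw [h2] at h1
    linear_combination h1
  have hlap : ∀ x, (Δ v) x = -(1 / (2 * omega3)) * ∫ y, f y / ‖x - y‖ ^ 2 := by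
    intro x
    have h1 := laplacian_eq_newtonian hv4 hΔ hf hfi hv x
    rw [integral_translate_div_norm_sq] at h1
    field_simp at h1 ⊢
    linarith
  -- Continuity of the Newtonian potential is read off from its identification with a multiple of
  -- the continuous function `Δv`.
  have hZ : Continuous fun x : R4 => ∫ y, f y / ‖x - y‖ ^ 2 := by
    have h1 : (fun x : R4 => ∫ y, f y / ‖x - y‖ ^ 2) = fun x => -(2 * omega3) * (Δ v) x := by
      ext x
      rw [hlap]
      field_simp
    rw [h1]
    exact (continuous_laplacian (hv4.of_le (by norm_num))).const_mul _
  obtain ⟨c₀, hc₀⟩ := hrep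
  refine ⟨⟨c₀, fun x => ⟨integrable_log_kernel hf hfi x, hc₀ x⟩⟩,
    fun x => ⟨integrable_gradient_kernel hf hfi x,
      hasGradientAt_of_log_representation hf hfi (fun y => (hf0 y).le) hZ hc₀ x⟩,
    fun x => ⟨integrable_div_norm_sq hf hfi x, hlap x⟩, fun hH => ?_⟩
  have hloc : ∃ s A C : ℝ, 1 < s ∧ 0 ≤ C ∧ ∀ᶠ x in cocompact R4,
      ∫ y in Metric.ball x 1, f y ^ s ≤ A * Real.exp (C * Real.log ‖x‖) := by
    rcases hH with h1 | h2
    -- The exponent `8 q₁` feeds the bound on `u`; below, `2 q₂` serves the square of `f`.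
    · obtain ⟨A, C, -, hC, hAC⟩ := exists_integral_exp_le hv4.continuous hf hfi hf0
        (show 0 ≤ 1 / (4 * omega3) by positivity) hc₀ (show 0 ≤ 8 * q₁ by positivity)
      obtain ⟨A₁, hA₁, hu⟩ := exists_le_exp_log hp₁ hp₁' hu2 hu0 hv4.continuous huv.eq_u
        huv.integrable_u h1.2 hC hAC
      obtain ⟨A₂, C₂, -, hC₂, hAC₂⟩ := exists_integral_exp_le hv4.continuous hf hfi hf0
        (show 0 ≤ 1 / (4 * omega3) by positivity) hc₀ (show 0 ≤ 2 * q₂ by positivity)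
      exact local_bound_of_polynomial_growth hp₂ hu0 hu2.continuous hv4.continuous hA₁ hC hC₂
        hu hAC₂
    · exact local_bound_of_H2 hp₂ hq₂ hu0 hu2.continuous hv4.continuous h2
  obtain ⟨s, A, C, hs, hC, hAC⟩ := hloc
  have := tendsto_div_log_of_local_bound hf hfi (fun y => (hf0 y).le) hc₀ hs hC hAC
  rwa [neg_mul] at this
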